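/- Let $V$ be a finite set and let $\Delta$ be a simplicial complex on $V$, that is, a collection of subsets of $V$ closed under taking subsets (elements of $V$ need not be faces). Suppose that $\Delta$ is a matroid complex, meaning that for every $W\subseteq V$ all inclusion-maximal elements of $\{F\in\Delta : F\subseteq W\}$ have the same cardinality, and that $\Delta$ has rank $3$ (equivalently, dimension $2$), meaning that the largest cardinality of a face of $\Delta$ is $3$. Let $f_{i-1}$ be the number of faces of $\Delta$ with exactly $i$ elements, and let the $h$-vector $(h_0,h_1,h_2,h_3)$ of $\Delta$ be defined by $$\sum_{i=0}^{3} f_{i-1}\,t^i(1-t)^{3-i}=\sum_{i=0}^{3} h_i t^i .$$ Then the $h$-vector of $\Delta$ is a pure $O$-sequence (up to trailing zeros): there are an integer $r\ge 0$ and a finite nonempty set $X$ of monomials in variables $y_1,\dots,y_r$ that is closed under taking divisors, all of whose maximal elements with respect to divisibility have the same degree, such that for every $i\ge 0$ the number of monomials of degree $i$ in $X$ is $h_i$ (where $h_i=0$ for $i>3$). -/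

import Mathlib

open scoped Polynomial

/-- A simplicial complex on the vertex set `V`: a collection of finite subsets of `V` that is closed
under passing to subsets, i.e. a lower set for inclusion.  The empty face is a face like any other
(it is the one counted by `f₋₁`), and a point of `V` need not be a face. (Mathlib's
`PreAbstractSimplicialComplex` leaves the empty face out.) -/
abbrev FaceComplex (V : Type*) := LowerSet (Finset V)

namespace FaceComplex

variable {V : Type*}

/-- The restriction of `Δ` to `W`: the faces of `Δ` that are contained in `W`. -/
def restrict (Δ : FaceComplex V) (W : Finset V) : FaceComplex V where
  carrier := {F | F ∈ Δ ∧ F ⊆ W}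
  lower' := fun _ _ hGF hF => ⟨Δ.lower hGF hF.1, hGF.trans hF.2⟩

/-- A facet is a face that is maximal under inclusion. -/
def IsFacet (Δ : FaceComplex V) (F : Finset V) : Prop :=
  Maximal (fun G => G ∈ Δ) F

/-- A complex is pure if all of its facets have the same dimension (equivalently, cardinality). -/
def IsPure (Δ : FaceComplex V) : Prop :=
  ∀ F G : Finset V, Δ.IsFacet F → Δ.IsFacet G → F.card = G.card

/-- A matroid complex: the restriction to every set of vertices is pure. -/
def IsMatroidComplex (Δ : FaceComplex V) : Prop :=
  ∀ W : Finset V, (Δ.restrict W).IsPure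

variable [Fintype V]

open Classical in
/-- The finite set of all faces. -/
noncomputable def faces (Δ : FaceComplex V) : Finset (Finset V) :=
  Finset.univ.filter (fun F => F ∈ Δ)

/-- The rank `d = dim Δ + 1`: the largest cardinality of a face (a face `F` has dimension
`|F| - 1`). -/
noncomputable def rank (Δ : FaceComplex V) : ℕ :=
  Δ.faces.sup Finset.card

/-- `Δ.faceCount i` is the number `f_{i-1}` of faces with `i` elements, i.e. of dimension
`i - 1`. -/
noncomputable def faceCount (Δ : FaceComplex V) (i : ℕ) : ℕ :=
  (Δ.faces.filter (fun F => F.card = i)).card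

/-- The polynomial `∑_{i=0}^d f_{i-1} t^i (1-t)^{d-i}`, where `d` is the rank. -/
noncomputable def hPolynomial (Δ : FaceComplex V) : ℤ[X] :=
  ∑ i ∈ Finset.range (Δ.rank + 1),
    (Δ.faceCount i : ℤ[X]) * Polynomial.X ^ i * (1 - Polynomial.X) ^ (Δ.rank - i)

/-- The `h`-vector `(h_0, …, h_d)`, defined by `∑ f_{i-1} t^i (1-t)^{d-i} = ∑ h_i t^i` and
continued by zeros. -/
noncomputable def hVector (Δ : FaceComplex V) (i : ℕ) : ℤ :=
  Δ.hPolynomial.coeff i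

end FaceComplex

/-! Monomials in `y_1, …, y_r` are given by their exponent vectors `Fin r →₀ ℕ`; divisibility of
monomials is the componentwise order, and the degree is `Finsupp.degree`. -/

/-- A (monomial) order ideal: a finite nonempty set of monomials closed under divisors. -/
def IsOrderIdeal {r : ℕ} (X : Finset (Fin r →₀ ℕ)) : Prop :=
  X.Nonempty ∧ ∀ M ∈ X, ∀ N : Fin r →₀ ℕ, N ≤ M → N ∈ X

/-- All maximal monomials (for divisibility) of `X` have the same degree. -/
def IsPureMonomialSet {r : ℕ} (X : Finset (Fin r →₀ ℕ)) : Prop :=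
  ∀ M N : Fin r →₀ ℕ, Maximal (fun P => P ∈ X) M → Maximal (fun P => P ∈ X) N →
    M.degree = N.degree

/-- The rank vector of `X`: the number of monomials of degree `i` in `X`. -/
noncomputable def rankVector {r : ℕ} (X : Finset (Fin r →₀ ℕ)) (i : ℕ) : ℕ :=
  (X.filter (fun M => M.degree = i)).card

/-- A sequence (continued by zeros) is a pure `O`-sequence if it is the rank vector of a pure
order ideal of monomials in finitely many variables. -/
def IsPureOSequence (h : ℕ → ℤ) : Prop :=
  ∃ (r : ℕ) (X : Finset (Fin r →₀ ℕ)), IsOrderIdeal X ∧ IsPureMonomialSet X ∧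
    ∀ i : ℕ, h i = (rankVector X i : ℤ)

/-! Discard the loops and let E be the n remaining elements (`nonloops`). Being parallel (`¬ Npar`)
is an equivalence relation on E. Take a basis B, a transversal R ⊇ B of the parallel classes, Z = R
\ B and Y = E \ R. The variables are the n - 3 elements of A = Z ∪ Y. Two variables are compatible
if one of them is in Z or if they are not parallel; so elements of Z may be repeated and those of Y
may not (`withFree`).

By `clique_counts`, exactly h₂ quadratic monomials have compatible factors, and the cubic ones
number h₃ plus the number of dependent triples of pairwise non-parallel elements. It therefore
suffices to choose h₃ cubic monomials such that every quadratic one divides one of them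
(`isPureOSequence_of_cliques`).

If Z is empty, there are three parallel classes, all transversals are bases, and all cubic monomials
are taken. If there is a coloop, h₃ = 0 and the ideal stops in degree 2. Otherwise fix z ∈ Z: the
monomials z³ and zuv, for u, v compatible and different from z, cover all pairs unless some variable
is compatible with z alone. There are at most h₂ - h₁ + 1 of them, so the inequality h₀ - h₁ + h₂ ≤
h₃ (`two_mul_faceCount_two_le`) leaves room to enlarge this cover to exactly h₃ monomials. In the
exceptional case only one parallel class is non-trivial, and the monomials z²y with y ∈ Y are few
enough (`exists_small_cover`).

The inequality comes from counting bases by their intersection with a line L. A suitable L either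
meets the complement of every parallel class in at least two elements (`IsWide`), or, if no line
does, has no two parallel elements off it. -/

/-! ### Multisets with pairwise compatible members -/

section Cliques

variable {V : Type*}

open Classical in
/-- The multisets of size `k` on `A` (monomials of degree `k`), any two of whose members are related
by `c`; a member that is repeated has to be related to itself. -/
noncomputable def cliques (c : V → V → Prop) (A : Finset V) (k : ℕ) : Finset (Multiset V) :=
  ((A.sym k).image (fun m : Sym V k => m.1)).filter (fun M => ∀ u v, {u, v} ≤ M → c u v)

theorem mem_cliques {c : V → V → Prop} {A : Finset V} {k : ℕ} {M : Multiset V} :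
    M ∈ cliques c A k ↔ M.card = k ∧ (∀ a ∈ M, a ∈ A) ∧ ∀ u v, {u, v} ≤ M → c u v := by
  classical
  simp only [cliques, Finset.mem_filter, Finset.mem_image, Finset.mem_sym_iff]
  constructor
  · rintro ⟨⟨m, hm, rfl⟩, h⟩
    exact ⟨m.2, fun a ha => hm a ha, h⟩
  · rintro ⟨h1, h2, h3⟩
    exact ⟨⟨⟨M, h1⟩, fun a ha => h2 a ha, rfl⟩, h3⟩

theorem cliques_card_zero (c : V → V → Prop) (A : Finset V) : (cliques c A 0).card = 1 := by
  rw [Finset.card_eq_one]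
  refine ⟨0, ?_⟩
  ext M
  simp only [mem_cliques, Multiset.card_eq_zero, Finset.mem_singleton]
  constructor
  · exact fun h => h.1
  · rintro rfl
    simp

theorem singleton_mem_cliques {c : V → V → Prop} {A : Finset V} {a : V} :
    {a} ∈ cliques c A 1 ↔ a ∈ A := by
  rw [mem_cliques]
  refine ⟨fun h => h.2.1 a (by simp), fun h => ⟨by simp, by simpa using h, fun u v huv => ?_⟩⟩
  have := Multiset.card_le_card huv
  simp at this

theorem cliques_card_one (c : V → V → Prop) (A : Finset V) : (cliques c A 1).card = A.card := by
  classical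
  have : cliques c A 1 = A.image (fun a => {a}) := by
    ext M
    rw [Finset.mem_image]
    constructor
    · intro h
      obtain ⟨a, rfl⟩ := Multiset.card_eq_one.1 (mem_cliques.1 h).1
      exact ⟨a, singleton_mem_cliques.1 h, rfl⟩
    · rintro ⟨a, ha, rfl⟩
      exact singleton_mem_cliques.2 ha
  rw [this, Finset.card_image_of_injective _ fun _ _ => Multiset.singleton_inj.1]

theorem cons_mem_cliques {c : V → V → Prop} (hc : ∀ u v, c u v → c v u) {A : Finset V} {k : ℕ}
    {a : V} {M : Multiset V} :
    a ::ₘ M ∈ cliques c A (k + 1) ↔ a ∈ A ∧ M ∈ cliques c A k ∧ ∀ u ∈ M, c a u := by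
  classical
  simp only [mem_cliques, Multiset.card_cons, Nat.add_right_cancel_iff, Multiset.forall_mem_cons]
  constructor
  · rintro ⟨h1, ⟨h2, h3⟩, h4⟩
    refine ⟨h2, ⟨h1, h3, fun u v h => h4 u v (h.trans (Multiset.le_cons_self M a))⟩, fun u hu => ?_⟩
    refine h4 a u ?_
    exact (Multiset.cons_le_cons_iff a).2 (Multiset.singleton_le.2 hu)
  · rintro ⟨h1, ⟨h2, h3, h4⟩, h5⟩
    refine ⟨h2, ⟨h1, h3⟩, fun u v h => ?_⟩
    by_cases hu : u = a
    · subst hu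
      exact h5 v (Multiset.singleton_le.1 ((Multiset.cons_le_cons_iff u).1 h))
    by_cases hv : v = a
    · subst hv
      rw [Multiset.pair_comm] at h
      exact hc _ _ (h5 u (Multiset.singleton_le.1 ((Multiset.cons_le_cons_iff v).1 h)))
    · refine h4 u v ((Multiset.le_cons_of_notMem ?_).1 h)
      simp [Ne.symm hu, Ne.symm hv]

theorem pair_mem_cliques {c : V → V → Prop} (hc : ∀ u v, c u v → c v u) {A : Finset V}
    {a b : V} : {a, b} ∈ cliques c A 2 ↔ a ∈ A ∧ b ∈ A ∧ c a b := by
  have := cons_mem_cliques hc (A := A) (k := 1) (a := a) (M := {b})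
  rw [Multiset.insert_eq_cons, this, singleton_mem_cliques]
  simp

theorem triple_mem_cliques {c : V → V → Prop} (hc : ∀ u v, c u v → c v u) {A : Finset V}
    {x y z : V} :
    {x, y, z} ∈ cliques c A 3 ↔ x ∈ A ∧ (y ∈ A ∧ z ∈ A ∧ c y z) ∧ c x y ∧ c x z := by
  have := cons_mem_cliques hc (A := A) (k := 2) (a := x) (M := {y, z})
  rw [Multiset.insert_eq_cons, this, pair_mem_cliques hc]
  simp

theorem cliques_of_le {c : V → V → Prop} {A : Finset V} {k : ℕ} {M N : Multiset V}
    (hM : M ∈ cliques c A k) (h : N ≤ M) : N ∈ cliques c A N.card := by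
  rw [mem_cliques] at *
  exact ⟨rfl, fun a ha => hM.2.1 a (Multiset.mem_of_le h ha), fun u v huv => hM.2.2 u v (huv.trans h)⟩

theorem cliques_mono {c d : V → V → Prop} {A B : Finset V} (hAB : A ⊆ B)
    (hcd : ∀ u ∈ A, ∀ v ∈ A, c u v → d u v) (k : ℕ) : cliques c A k ⊆ cliques d B k := by
  intro M hM
  rw [mem_cliques] at *
  refine ⟨hM.1, fun a ha => hAB (hM.2.1 a ha), fun u v h => hcd u ?_ v ?_ (hM.2.2 u v h)⟩
  · exact hM.2.1 u (Multiset.mem_of_le h (by simp))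
  · exact hM.2.1 v (Multiset.mem_of_le h (by simp))

/-- Removing one copy of `a` turns the cliques through `a` into cliques on its relatives `N`. Here
`a` itself belongs to `N` exactly when `c a a`, which is how higher powers of `a` are counted. -/
theorem cliques_card_insert [DecidableEq V] {c : V → V → Prop} (hc : ∀ u v, c u v → c v u) {A N : Finset V}
    {a : V} (ha : a ∉ A) (hN : ∀ u, u ∈ N ↔ u ∈ insert a A ∧ c a u) (k : ℕ) :
    (cliques c (insert a A) (k + 1)).card =
      (cliques c A (k + 1)).card + (cliques c N k).card := by
  have key : cliques c (insert a A) (k + 1) =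
      cliques c A (k + 1) ∪ (cliques c N k).image (Multiset.cons a) := by
    ext M
    simp only [Finset.mem_union, Finset.mem_image]
    constructor
    · intro h
      by_cases haM : a ∈ M
      · right
        obtain ⟨M', rfl⟩ := Multiset.exists_cons_of_mem haM
        rw [cons_mem_cliques hc] at h
        refine ⟨M', ?_, rfl⟩
        obtain ⟨-, h2, h3⟩ := h
        rw [mem_cliques] at *
        exact ⟨h2.1, fun u hu => (hN u).2 ⟨h2.2.1 u hu, h3 u hu⟩, h2.2.2⟩
      · left
        rw [mem_cliques] at *
        refine ⟨h.1, fun u hu => (Finset.mem_insert.1 (h.2.1 u hu)).resolve_left ?_, h.2.2⟩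
        rintro rfl
        exact haM hu
    · rintro (h | ⟨M', h, rfl⟩)
      · exact cliques_mono (Finset.subset_insert a A) (fun _ _ _ _ h => h) _ h
      · rw [cons_mem_cliques hc]
        refine ⟨by simp, cliques_mono (fun u hu => ((hN u).1 hu).1) (fun _ _ _ _ h => h) _ h, ?_⟩
        intro u hu
        exact ((hN u).1 ((mem_cliques.1 h).2.1 u hu)).2
  rw [key, Finset.card_union_of_disjoint,
    Finset.card_image_of_injective _ fun _ _ => (Multiset.cons_inj_right a).1]
  rw [Finset.disjoint_left]
  intro M h1 h2
  simp only [Finset.mem_image] at h2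
  obtain ⟨M', -, rfl⟩ := h2
  exact ha ((mem_cliques.1 h1).2.1 a (by simp))

end Cliques

/-! ### From compatible multisets to pure order ideals -/

section Pure

variable {V : Type*} [Fintype V]

/-- A finite set of multisets, read as monomials in the elements of `V`, that is closed under
divisors and in which only monomials of the largest degree are maximal, gives a pure
`O`-sequence. -/
theorem isPureOSequence_of_multisets (X : Finset (Multiset V)) (h : ℕ → ℤ) (hne : X.Nonempty)
    (hlow : ∀ M ∈ X, ∀ N, N ≤ M → N ∈ X)
    (hpure : ∀ M ∈ X, ∀ N ∈ X, M.card < N.card → ∃ P ∈ X, M < P)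
    (hcard : ∀ i, h i = ((X.filter (fun M => M.card = i)).card : ℤ)) : IsPureOSequence h := by
  classical
  let e : V ≃ Fin (Fintype.card V) := Fintype.equivFin V
  let φ : Multiset V ≃ (Fin (Fintype.card V) →₀ ℕ) :=
    Multiset.toFinsupp.toEquiv.trans (Finsupp.domCongr e).toEquiv
  have hφ : ∀ M i, φ M i = M.count (e.symm i) := fun M i => by
    simp [φ, Finsupp.domCongr, Finsupp.equivMapDomain_apply]
  have hle : ∀ M N, φ M ≤ φ N ↔ M ≤ N := fun M N => by
    rw [Multiset.le_iff_count, Finsupp.le_def]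
    simp only [hφ]
    exact ⟨fun H a => by simpa using H (e a), fun H i => H _⟩
  have hdeg : ∀ M, (φ M).degree = M.card := fun M => by
    rw [Finsupp.degree_eq_sum]
    simp only [hφ]
    rw [Equiv.sum_comp e.symm (fun a => M.count a)]
    exact Multiset.sum_count_eq_card (by simp)
  have hmem : ∀ P, P ∈ X.map φ.toEmbedding ↔ φ.symm P ∈ X := fun P => by
    simp [Finset.mem_map_equiv]
  -- A maximal monomial has the largest degree in the ideal; applied both ways, this gives purity.
  have hmax : ∀ P Q, Maximal (fun P => P ∈ X.map φ.toEmbedding) P → Q ∈ X.map φ.toEmbedding →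
      Q.degree ≤ P.degree := by
    intro P Q hP hQ
    obtain ⟨M, rfl⟩ := φ.surjective P
    obtain ⟨N, rfl⟩ := φ.surjective Q
    rw [hdeg, hdeg]
    by_contra! hlt
    rw [hmem, Equiv.symm_apply_apply] at hQ
    have hM := hP.prop
    rw [hmem, Equiv.symm_apply_apply] at hM
    obtain ⟨P', hP', hlt'⟩ := hpure M hM N hQ hlt
    have := hP.le_of_ge (y := φ P') (by rw [hmem, Equiv.symm_apply_apply]; exact hP')
      ((hle _ _).2 hlt'.le)
    exact hlt'.not_ge ((hle _ _).1 this)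
  refine ⟨Fintype.card V, X.map φ.toEmbedding, ⟨by simpa using hne, ?_⟩, ?_, ?_⟩
  · intro M hM N hN
    obtain ⟨M, rfl⟩ := φ.surjective M
    obtain ⟨N, rfl⟩ := φ.surjective N
    rw [hmem, Equiv.symm_apply_apply] at *
    exact hlow M hM N ((hle _ _).1 hN)
  · intro M N hM hN
    exact le_antisymm (hmax N M hN hM.prop) (hmax M N hM hN.prop)
  · intro i
    rw [hcard, rankVector, Finset.filter_map, Finset.card_map]
    congr 2
    refine Finset.filter_congr fun M _ => ?_
    simp [hdeg]

/-- The order ideal made of all cliques of size at most two and of the 3-cliques in `S`. -/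
theorem isPureOSequence_of_cliques (c : V → V → Prop) (A : Finset V) (S : Finset (Multiset V))
    (h : ℕ → ℤ) (hS : S ⊆ cliques c A 3)
    (h₁ : (cliques c A 2).Nonempty → ∀ a ∈ A, ∃ P ∈ cliques c A 2, a ∈ P)
    (h₂ : S.Nonempty → ∀ P ∈ cliques c A 2, ∃ Q ∈ S, P ≤ Q)
    (e₀ : h 0 = 1) (e₁ : h 1 = A.card) (e₂ : h 2 = (cliques c A 2).card) (e₃ : h 3 = S.card)
    (e₄ : ∀ i, 4 ≤ i → h i = 0) : IsPureOSequence h := by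
  classical
  have hSc : ∀ M ∈ S, M.card = 3 := fun M hM => (mem_cliques.1 (hS hM)).1
  have hcc : ∀ k, ∀ M ∈ cliques c A k, M.card = k := fun k M hM => (mem_cliques.1 hM).1
  let X : Finset (Multiset V) := cliques c A 0 ∪ cliques c A 1 ∪ cliques c A 2 ∪ S
  have hX : ∀ M, M ∈ X ↔ M ∈ cliques c A 0 ∨ M ∈ cliques c A 1 ∨ M ∈ cliques c A 2 ∨ M ∈ S := by
    intro M; simp only [X, Finset.mem_union, or_assoc]
  have hXcl : ∀ M ∈ X, M ∈ cliques c A M.card ∧ M.card ≤ 3 := by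
    intro M hM
    rcases (hX M).1 hM with h | h | h | h
    · rw [hcc _ _ h]; exact ⟨h, by omega⟩
    · rw [hcc _ _ h]; exact ⟨h, by omega⟩
    · rw [hcc _ _ h]; exact ⟨h, by omega⟩
    · rw [hSc _ h]; exact ⟨hS h, le_rfl⟩
  have hX2 : ∀ M, M ∈ cliques c A M.card → M.card ≤ 2 → M ∈ X := by
    intro M hM hk
    rw [hX]
    generalize hm : M.card = m at *
    interval_cases m <;> simp [hM]
  have hX3 : ∀ M ∈ X, M.card = 3 → M ∈ S := by
    intro M hM h3
    rcases (hX M).1 hM with h | h | h | h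
    · have := hcc _ _ h; omega
    · have := hcc _ _ h; omega
    · have := hcc _ _ h; omega
    · exact h
  have hlow : ∀ M ∈ X, ∀ N, N ≤ M → N ∈ X := by
    intro M hM N hNM
    by_cases hN : N.card ≤ 2
    · exact hX2 N (cliques_of_le (hXcl M hM).1 hNM) hN
    · have := (hXcl M hM).2
      rw [Multiset.eq_of_le_of_card_le hNM (by omega)]
      exact hM
  have hfil : ∀ i, i ≤ 2 → X.filter (fun M => M.card = i) = cliques c A i := by
    intro i hi
    ext M
    rw [Finset.mem_filter]
    constructor
    · rintro ⟨h, rfl⟩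
      exact (hXcl M h).1
    · intro h
      have := hcc _ _ h
      subst this
      exact ⟨hX2 M h hi, rfl⟩
  have hsub : ∀ M ∈ X, 2 ≤ M.card → (cliques c A 2).Nonempty := by
    intro M hM hc2
    obtain ⟨N, hN⟩ := Multiset.card_pos_iff_exists_mem.1
      (by rw [Multiset.card_powersetCard]; exact Nat.choose_pos hc2 : 0 < (M.powersetCard 2).card)
    obtain ⟨hN, hN2⟩ := Multiset.mem_powersetCard.1 hN
    exact ⟨N, hN2 ▸ cliques_of_le (hXcl M hM).1 hN⟩
  refine isPureOSequence_of_multisets X h ⟨0, hX2 0 ?_ (by simp)⟩ hlow ?_ ?_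
  · rw [mem_cliques]; simp
  · intro M hM N hN hlt
    have hN3 := (hXcl N hN).2
    have hMc := (hXcl M hM).1
    generalize hm : M.card = m at hMc hlt
    have : m ≤ 2 := by omega
    have key : ∀ P ∈ X, M ≤ P → m < P.card → M < P := fun P _ h h' =>
      lt_of_le_of_ne h (fun h => by subst h; omega)
    interval_cases m
    · exact ⟨N, hN, key N hN (by rw [Multiset.card_eq_zero.1 hm]; exact Multiset.zero_le N) hlt⟩
    · obtain ⟨a, rfl⟩ := Multiset.card_eq_one.1 hm
      obtain ⟨P, hP, haP⟩ := h₁ (hsub N hN hlt) a ((mem_cliques.1 hMc).2.1 a (by simp))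
      have hPX : P ∈ X := (hX P).2 (by simp [hP])
      exact ⟨P, hPX, key P hPX (by simpa using haP) (by rw [hcc _ _ hP]; omega)⟩
    · have hNS := hX3 N hN (by omega)
      obtain ⟨Q, hQ, hMQ⟩ := h₂ ⟨N, hNS⟩ M hMc
      have hQX : Q ∈ X := (hX Q).2 (by simp [hQ])
      exact ⟨Q, hQX, key Q hQX hMQ (by rw [hSc _ hQ]; omega)⟩
  · intro i
    obtain hi | rfl | hi : i ≤ 2 ∨ i = 3 ∨ 4 ≤ i := by omega
    · rw [hfil i hi]
      interval_cases i
      · rw [e₀, cliques_card_zero]; rfl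
      · rw [e₁, cliques_card_one]
      · exact e₂
    · rw [e₃]
      congr 2
      ext M
      rw [Finset.mem_filter]
      exact ⟨fun h => ⟨(hX M).2 (by simp [h]), hSc M h⟩, fun h => hX3 M h.1 h.2⟩
    · rw [e₄ i hi, Finset.filter_false_of_mem]
      · rfl
      · intro M hM
        have := (hXcl M hM).2
        omega

end Pure

/-! ### Matroid complexes: exchange, parallel elements, lines in rank three -/

namespace FaceComplex

variable {V : Type*} {Δ : FaceComplex V}

theorem mem_of_subset {F G : Finset V} (hF : F ∈ Δ) (h : G ⊆ F) : G ∈ Δ := Δ.lower h hF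

section

variable [Fintype V]

open Classical in
/-- The vertices that are faces. -/
noncomputable def nonloops (Δ : FaceComplex V) : Finset V := Finset.univ.filter fun x => {x} ∈ Δ

theorem mem_nonloops {x : V} : x ∈ Δ.nonloops ↔ {x} ∈ Δ := by simp [nonloops]

theorem mem_faces {F : Finset V} : F ∈ Δ.faces ↔ F ∈ Δ := by simp [faces]

theorem subset_nonloops {F : Finset V} (hF : F ∈ Δ) : F ⊆ Δ.nonloops := fun x hx =>
  mem_nonloops.2 (mem_of_subset hF (by simpa using hx))

theorem card_le_rank {F : Finset V} (hF : F ∈ Δ) : F.card ≤ Δ.rank :=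
  Finset.le_sup (f := Finset.card) (mem_faces.2 hF)

theorem exists_card_eq_rank {F : Finset V} (hF : F ∈ Δ) : ∃ B ∈ Δ, B.card = Δ.rank := by
  obtain ⟨B, hB, h⟩ := Finset.exists_mem_eq_sup Δ.faces ⟨F, mem_faces.2 hF⟩ Finset.card
  exact ⟨B, mem_faces.1 hB, h.symm⟩

end

variable [DecidableEq V]

/-- Two distinct vertices spanning an edge; in a matroid complex, non-parallel non-loops. -/
def Npar (Δ : FaceComplex V) (x y : V) : Prop := x ≠ y ∧ ({x, y} : Finset V) ∈ Δ

theorem Npar.symm {x y : V} (h : Δ.Npar x y) : Δ.Npar y x :=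
  ⟨h.1.symm, by rw [Finset.pair_comm]; exact h.2⟩

theorem npar_comm (Δ : FaceComplex V) : ∀ u v, Δ.Npar u v → Δ.Npar v u := fun _ _ h => h.symm

theorem npar_irrefl {x : V} : ¬ Δ.Npar x x := fun h => h.1 rfl

theorem npar_of_mem {F : Finset V} (hF : F ∈ Δ) {x y : V} (hx : x ∈ F) (hy : y ∈ F)
    (hxy : x ≠ y) : Δ.Npar x y :=
  ⟨hxy, mem_of_subset hF (by intro z; simp only [Finset.mem_insert, Finset.mem_singleton]; aesop)⟩

theorem Npar.left {x y : V} (h : Δ.Npar x y) : ({x} : Finset V) ∈ Δ :=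
  mem_of_subset h.2 (by simp)

theorem Npar.right {x y : V} (h : Δ.Npar x y) : ({y} : Finset V) ∈ Δ := h.symm.left

variable [Fintype V]

namespace IsMatroidComplex

/-- Purity of the restriction to `G ∪ F`: a facet of it above `G` is as large as one above `F`. -/
theorem exists_extension (hΔ : Δ.IsMatroidComplex) {F G : Finset V} (hG : G ∈ Δ) (hF : F ∈ Δ) :
    ∃ I ∈ Δ, G ⊆ I ∧ I ⊆ G ∪ F ∧ F.card ≤ I.card := by
  have key : ∀ H, H ∈ Δ → H ⊆ G ∪ F → ∃ I, H ⊆ I ∧ (Δ.restrict (G ∪ F)).IsFacet I := by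
    intro H h1 h2
    obtain ⟨I, hI, hI'⟩ := (Set.toFinite {I : Finset V | I ∈ Δ.restrict (G ∪ F)}).exists_le_maximal
      (a := H) ⟨h1, h2⟩
    exact ⟨I, hI, hI'⟩
  obtain ⟨I, hI, hI'⟩ := key G hG Finset.subset_union_left
  obtain ⟨J, hJ, hJ'⟩ := key F hF Finset.subset_union_right
  refine ⟨I, hI'.prop.1, hI, hI'.prop.2, ?_⟩
  rw [hΔ _ I J hI' hJ']
  exact Finset.card_le_card hJ

theorem exists_augment (hΔ : Δ.IsMatroidComplex) {F G : Finset V} (hG : G ∈ Δ) (hF : F ∈ Δ)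
    (h : G.card < F.card) : ∃ x ∈ F, x ∉ G ∧ insert x G ∈ Δ := by
  obtain ⟨I, hI, h1, h2, h3⟩ := hΔ.exists_extension hG hF
  obtain ⟨x, hx, hxG⟩ := Finset.exists_mem_notMem_of_card_lt_card (h.trans_le h3)
  exact ⟨x, (Finset.mem_union.1 (h2 hx)).resolve_left hxG, hxG,
    mem_of_subset hI (Finset.insert_subset hx h1)⟩

/-- Transitivity of parallelism in contrapositive form, obtained by augmenting `{y}` from the edge
`{x, z}`. -/
theorem npar_or_npar (hΔ : Δ.IsMatroidComplex) {x y z : V} (hy : {y} ∈ Δ) (h : Δ.Npar x z) :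
    Δ.Npar y x ∨ Δ.Npar y z := by
  obtain ⟨w, hw, hwy, hI⟩ := hΔ.exists_augment hy h.2 (by
    rw [Finset.card_pair h.1, Finset.card_singleton]; omega)
  rw [Finset.pair_comm] at hI
  rw [Finset.mem_singleton] at hwy
  simp only [Finset.mem_insert, Finset.mem_singleton] at hw
  rcases hw with rfl | rfl
  · exact Or.inl ⟨fun h => hwy h.symm, hI⟩
  · exact Or.inr ⟨fun h => hwy h.symm, hI⟩

/-- An element can be exchanged for a parallel one. -/
theorem insert_erase_mem (hΔ : Δ.IsMatroidComplex) {F : Finset V} (hF : F ∈ Δ) {r x : V}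
    (hr : r ∈ F) (hx : {x} ∈ Δ) (hrx : ¬ Δ.Npar r x) : insert x (F.erase r) ∈ Δ := by
  obtain ⟨I, hI, h1, h2, h3⟩ := hΔ.exists_extension hx hF
  by_cases hxr : x = r
  · subst hxr
    rwa [Finset.insert_erase hr]
  have hxI : x ∈ I := h1 (by simp)
  have hrI : r ∉ I := fun h => hrx (npar_of_mem hI h hxI (Ne.symm hxr))
  have hsub : I ⊆ insert x (F.erase r) := by
    intro z hz
    have := h2 hz
    simp only [Finset.mem_union, Finset.mem_singleton] at this
    rw [Finset.mem_insert, Finset.mem_erase]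
    refine this.imp_right fun h => ⟨fun hzr => hrI (hzr ▸ hz), h⟩
  have hle : (insert x (F.erase r)).card ≤ F.card := by
    have := Finset.card_insert_le x (F.erase r)
    rw [Finset.card_erase_of_mem hr] at this
    have : 0 < F.card := Finset.card_pos.2 ⟨r, hr⟩
    omega
  rw [← Finset.eq_of_subset_of_card_le hsub (hle.trans h3)]
  exact hI

end IsMatroidComplex

theorem IsMatroidComplex.exists_basis (hΔ : Δ.IsMatroidComplex) {F : Finset V} (hF : F ∈ Δ) :
    ∃ B ∈ Δ, F ⊆ B ∧ B.card = Δ.rank := by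
  obtain ⟨B, hB, hc⟩ := exists_card_eq_rank hF
  obtain ⟨I, hI, h1, h2, h3⟩ := hΔ.exists_extension hF hB
  exact ⟨I, hI, h1, le_antisymm (card_le_rank hI) (hc ▸ h3)⟩

/-- The line through `a` and `b` in a complex of rank three. -/
noncomputable def line (Δ : FaceComplex V) (a b : V) : Finset V :=
  open Classical in Δ.nonloops.filter fun x => ¬ (x ≠ a ∧ x ≠ b ∧ ({x, a, b} : Finset V) ∈ Δ)

theorem mem_line {a b x : V} :
    x ∈ Δ.line a b ↔ x ∈ Δ.nonloops ∧ ¬ (x ≠ a ∧ x ≠ b ∧ ({x, a, b} : Finset V) ∈ Δ) := by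
  simp [line]

theorem line_subset (a b : V) : Δ.line a b ⊆ Δ.nonloops := fun _ h => (mem_line.1 h).1

theorem left_mem_line {a b : V} (h : Δ.Npar a b) : a ∈ Δ.line a b :=
  mem_line.2 ⟨mem_nonloops.2 h.left, fun h => h.1 rfl⟩

theorem right_mem_line {a b : V} (h : Δ.Npar a b) : b ∈ Δ.line a b :=
  mem_line.2 ⟨mem_nonloops.2 h.right, fun h => h.2.1 rfl⟩

namespace IsMatroidComplex

/-- A larger face inside the line would augment `{a, b}` by an element of the line. -/
theorem card_le_two_of_subset_line (hΔ : Δ.IsMatroidComplex) {a b : V} (hab : Δ.Npar a b)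
    {F : Finset V} (hF : F ∈ Δ) (h : F ⊆ Δ.line a b) : F.card ≤ 2 := by
  by_contra! hc
  obtain ⟨x, hx, hxn, hI⟩ := hΔ.exists_augment hab.2 hF (by rw [Finset.card_pair hab.1]; exact hc)
  simp only [Finset.mem_insert, Finset.mem_singleton, not_or] at hxn
  exact (mem_line.1 (h hx)).2 ⟨hxn.1, hxn.2, hI⟩

/-- Augment `{x, y}` from the basis `{c, a, b}`. The new element cannot be on the line, which has
rank two, so it is `c`. -/
theorem mem_of_mem_line (hΔ : Δ.IsMatroidComplex) {a b x y c : V} (hab : Δ.Npar a b)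
    (hx : x ∈ Δ.line a b) (hy : y ∈ Δ.line a b) (hxy : Δ.Npar x y) (hc : c ∈ Δ.nonloops)
    (hcl : c ∉ Δ.line a b) : ({c, x, y} : Finset V) ∈ Δ := by
  have hc' := hcl
  rw [mem_line] at hc'
  push Not at hc'
  obtain ⟨h1, h2, h3⟩ := hc' hc
  have hcard : ({c, a, b} : Finset V).card = 3 := by
    rw [Finset.card_insert_of_notMem (by simp [h1, h2]), Finset.card_pair hab.1]
  obtain ⟨z, hz, hzn, hI⟩ := hΔ.exists_augment hxy.2 h3 (by rw [Finset.card_pair hxy.1]; omega)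
  have hzl : z ∉ Δ.line a b := by
    intro hzl
    have := hΔ.card_le_two_of_subset_line hab hI (by
      intro w; simp only [Finset.mem_insert, Finset.mem_singleton]
      rintro (rfl | rfl | rfl) <;> assumption)
    rw [Finset.card_insert_of_notMem hzn, Finset.card_pair hxy.1] at this
    omega
  simp only [Finset.mem_insert, Finset.mem_singleton] at hz
  rcases hz with rfl | rfl | rfl
  · exact hI
  · exact (hzl (left_mem_line hab)).elim
  · exact (hzl (right_mem_line hab)).elim

/-- Elements off a line are not parallel to elements of the line. -/
theorem npar_of_notMem_line (hΔ : Δ.IsMatroidComplex) {a b x c : V} (hab : Δ.Npar a b)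
    (hx : x ∈ Δ.line a b) (hc : c ∈ Δ.nonloops) (hcl : c ∉ Δ.line a b) : Δ.Npar c x := by
  have hcx : c ≠ x := by rintro rfl; exact hcl hx
  have key : ∀ y, y ∈ Δ.line a b → Δ.Npar x y → Δ.Npar c x := fun y hy hxy =>
    npar_of_mem (hΔ.mem_of_mem_line hab hx hy hxy hc hcl) (by simp) (by simp) hcx
  rcases hΔ.npar_or_npar (mem_nonloops.1 (line_subset _ _ hx)) hab with h | h
  · exact key a (left_mem_line hab) h
  · exact key b (right_mem_line hab) h

/-- The elements of a line that lie on the line through `c` and `d` are parallel. -/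
theorem mem_or_mem_of_npar (hΔ : Δ.IsMatroidComplex) {a b x y c d : V} (hab : Δ.Npar a b)
    (hx : x ∈ Δ.line a b) (hy : y ∈ Δ.line a b) (hxy : Δ.Npar x y) (hcl : c ∉ Δ.line a b)
    (hcd : Δ.Npar c d) : ({x, c, d} : Finset V) ∈ Δ ∨ ({y, c, d} : Finset V) ∈ Δ := by
  have hcE := mem_nonloops.2 hcd.left
  have h3 := hΔ.mem_of_mem_line hab hx hy hxy hcE hcl
  have hcx : c ≠ x := by rintro rfl; exact hcl hx
  have hcy : c ≠ y := by rintro rfl; exact hcl hy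
  have hcard : ({c, x, y} : Finset V).card = 3 := by
    rw [Finset.card_insert_of_notMem (by simp [hcx, hcy]), Finset.card_pair hxy.1]
  obtain ⟨z, hz, hzn, hI⟩ := hΔ.exists_augment hcd.2 h3 (by rw [Finset.card_pair hcd.1]; omega)
  simp only [Finset.mem_insert, Finset.mem_singleton] at hz
  rcases hz with rfl | rfl | rfl
  · simp at hzn
  · exact Or.inl hI
  · exact Or.inr hI

end IsMatroidComplex

end FaceComplex

/-! ### Faces as cliques, and the h-vector in terms of face numbers -/

namespace FaceComplex

variable {V : Type*} [DecidableEq V] {Δ : FaceComplex V}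

theorem val_mem_cliques {F W : Finset V} (hF : F ∈ Δ) (hW : F ⊆ W) :
    F.val ∈ cliques Δ.Npar W F.card := by
  rw [mem_cliques]
  refine ⟨rfl, fun a ha => hW ha, fun u v h => ?_⟩
  have hnd : u ≠ v := by simpa using Multiset.nodup_of_le h F.nodup
  exact npar_of_mem hF (Multiset.mem_of_le h (by simp)) (Multiset.mem_of_le h (by simp)) hnd

theorem nodup_of_mem_cliques {W : Finset V} {k : ℕ} {M : Multiset V}
    (hM : M ∈ cliques Δ.Npar W k) : M.Nodup := by
  rw [Multiset.nodup_iff_le]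
  exact fun a h => npar_irrefl ((mem_cliques.1 hM).2.2 a a h)

variable [Fintype V]

theorem card_filter_faces_le (W : Finset V) (k : ℕ) :
    (Δ.faces.filter fun F => F.card = k ∧ F ⊆ W).card ≤ (cliques Δ.Npar W k).card := by
  refine Finset.card_le_card_of_injOn Finset.val ?_ (fun _ _ _ _ h => Finset.val_injective h)
  intro F hF
  simp only [Finset.coe_filter, Set.mem_ofPred_eq, mem_faces] at hF
  obtain ⟨h1, rfl, h2⟩ := hF
  exact val_mem_cliques h1 h2

/-- If all cliques of size `k` come from faces, the two are equinumerous. -/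
theorem card_cliques_le (W : Finset V) (k : ℕ)
    (h : ∀ F : Finset V, F.val ∈ cliques Δ.Npar W k → F ∈ Δ) :
    (cliques Δ.Npar W k).card ≤ (Δ.faces.filter fun F => F.card = k ∧ F ⊆ W).card := by
  refine Finset.card_le_card_of_injOn Multiset.toFinset ?_ ?_
  · intro M hM
    have hnd := nodup_of_mem_cliques hM
    have hv : M.toFinset.val = M := by rw [Multiset.toFinset_val, hnd.dedup]
    simp only [Finset.coe_filter, Set.mem_ofPred_eq, mem_faces]
    refine ⟨h _ (by rw [hv]; exact hM), ?_, ?_⟩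
    · rw [Finset.card_def, hv]
      exact (mem_cliques.1 hM).1
    · intro a ha
      exact (mem_cliques.1 hM).2.1 a (by simpa using ha)
  · intro M hM N hN hMN
    have := congrArg Finset.val hMN
    rwa [Multiset.toFinset_val, Multiset.toFinset_val, (nodup_of_mem_cliques hM).dedup,
      (nodup_of_mem_cliques hN).dedup] at this

theorem card_filter_faces_two (W : Finset V) :
    (Δ.faces.filter fun F => F.card = 2 ∧ F ⊆ W).card = (cliques Δ.Npar W 2).card := by
  refine le_antisymm (card_filter_faces_le W 2) (card_cliques_le W 2 fun F hF => ?_)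
  obtain ⟨x, y, hxy, rfl⟩ := Finset.card_eq_two.1 (mem_cliques.1 hF).1
  have : ({x, y} : Finset V).val = {x, y} := by simp [Finset.insert_val, hxy]
  rw [this, pair_mem_cliques Δ.npar_comm] at hF
  exact hF.2.2.2

theorem faceCount_eq (k : ℕ) :
    Δ.faceCount k = (Δ.faces.filter fun F => F.card = k ∧ F ⊆ Δ.nonloops).card := by
  rw [faceCount]
  congr 1
  refine Finset.filter_congr fun F hF => ?_
  simp [subset_nonloops (mem_faces.1 hF)]

theorem faceCount_two : Δ.faceCount 2 = (cliques Δ.Npar Δ.nonloops 2).card := by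
  rw [faceCount_eq, card_filter_faces_two]

theorem faceCount_le (k : ℕ) : Δ.faceCount k ≤ (cliques Δ.Npar Δ.nonloops k).card := by
  rw [faceCount_eq]
  exact card_filter_faces_le _ _

theorem faceCount_one : Δ.faceCount 1 = Δ.nonloops.card := by
  refine le_antisymm ((faceCount_le 1).trans (cliques_card_one _ _).le) ?_
  rw [faceCount]
  refine Finset.card_le_card_of_injOn (fun x => {x}) ?_ fun _ _ _ _ h => Finset.singleton_inj.1 h
  intro x hx
  simpa [mem_faces] using mem_nonloops.1 hx

theorem faceCount_zero (h : (∅ : Finset V) ∈ Δ) : Δ.faceCount 0 = 1 := by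
  rw [faceCount, Finset.card_eq_one]
  refine ⟨∅, ?_⟩
  ext F
  simp only [Finset.mem_filter, mem_faces, Finset.card_eq_zero, Finset.mem_singleton]
  exact ⟨fun h => h.2, fun hF => ⟨hF ▸ h, hF⟩⟩

theorem hVector_of_rank_three (hr : Δ.rank = 3) :
    Δ.hVector 0 = 1 ∧ Δ.hVector 1 = Δ.nonloops.card - 3 ∧
    Δ.hVector 2 = Δ.faceCount 2 - 2 * Δ.nonloops.card + 3 ∧
    Δ.hVector 3 = Δ.faceCount 3 - Δ.faceCount 2 + Δ.nonloops.card - 1 ∧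
    ∀ i, 4 ≤ i → Δ.hVector i = 0 := by
  -- A complex without any face has rank 0, the supremum over the empty set.
  have h0 : (∅ : Finset V) ∈ Δ := by
    by_contra h
    have : Δ.faces = ∅ := by
      rw [Finset.eq_empty_iff_forall_notMem]
      exact fun F hF => h (mem_of_subset (mem_faces.1 hF) (Finset.empty_subset F))
    rw [rank, this] at hr
    simp at hr
  have key : Δ.hPolynomial = Polynomial.C 1 +
      Polynomial.C ((Δ.nonloops.card : ℤ) - 3) * Polynomial.X ^ 1 +
      Polynomial.C ((Δ.faceCount 2 : ℤ) - 2 * Δ.nonloops.card + 3) * Polynomial.X ^ 2 +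
      Polynomial.C ((Δ.faceCount 3 : ℤ) - Δ.faceCount 2 + Δ.nonloops.card - 1) *
        Polynomial.X ^ 3 := by
    rw [hPolynomial, hr]
    simp only [Finset.sum_range_succ, Finset.sum_range_zero, faceCount_zero h0, faceCount_one]
    simp only [map_sub, map_add, map_mul, map_one, map_ofNat,
      map_natCast, Nat.cast_one, Nat.sub_zero, Nat.reduceSub]
    ring
  simp only [hVector, key, Polynomial.coeff_add, Polynomial.coeff_C_mul, Polynomial.coeff_X_pow,
    Polynomial.coeff_C]
  refine ⟨by simp, by simp, by simp, by simp, fun i hi => ?_⟩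
  have h1 : i ≠ 0 := by omega
  have h2 : i ≠ 1 := by omega
  have h3 : i ≠ 2 := by omega
  have h4 : i ≠ 3 := by omega
  simp [h1, h2, h3, h4]

end FaceComplex

/-! ### Exact clique counts, with free elements and over a transversal -/

section Counting

variable {V : Type*}

/-- The relation in which the elements of `Z` are related to everything, themselves included. -/
def withFree (r : V → V → Prop) (Z : Finset V) (u v : V) : Prop := u ∈ Z ∨ v ∈ Z ∨ r u v

theorem withFree_symm (hr : ∀ u v, r u v → r v u) (Z : Finset V) (u v : V)
    (h : withFree r Z u v) : withFree r Z v u := by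
  rcases h with h | h | h
  · exact Or.inr (Or.inl h)
  · exact Or.inl h
  · exact Or.inr (Or.inr (hr _ _ h))

variable [DecidableEq V]

theorem cliques_card_complete {c : V → V → Prop} (hc : ∀ u v, c u v → c v u) (Z : Finset V)
    (h : ∀ u ∈ Z, ∀ v ∈ Z, c u v) :
    2 * (cliques c Z 2).card = Z.card * (Z.card + 1) ∧
    6 * (cliques c Z 3).card = Z.card * (Z.card + 1) * (Z.card + 2) := by
  induction Z using Finset.induction_on with
  | empty =>
    have : ∀ k, cliques c ∅ (k + 1) = ∅ := fun k => by
      rw [Finset.eq_empty_iff_forall_notMem]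
      intro M hM
      rw [mem_cliques] at hM
      obtain ⟨a, ha⟩ := Multiset.card_pos_iff_exists_mem.1 (by rw [hM.1]; exact k.succ_pos)
      exact Finset.notMem_empty a (hM.2.1 a ha)
    simp [this]
  | insert a Z ha ih =>
    obtain ⟨ih2, ih3⟩ := ih fun u hu v hv => h u (by simp [hu]) v (by simp [hv])
    have hN : ∀ u, u ∈ insert a Z ↔ u ∈ insert a Z ∧ c a u := fun u =>
      ⟨fun hu => ⟨hu, h a (by simp) u hu⟩, fun hu => hu.1⟩
    have e2 := cliques_card_insert hc ha hN 1
    have e3 := cliques_card_insert hc ha hN 2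
    rw [cliques_card_one, Finset.card_insert_of_notMem ha] at e2
    rw [Finset.card_insert_of_notMem ha]
    constructor
    · rw [e2]; linear_combination ih2
    · rw [e3, e2]; linear_combination ih3 + 3 * ih2

variable {r : V → V → Prop}

theorem cliques_card_insert_of_irrefl (hr : ∀ u v, r u v → r v u) (hi : ∀ u, ¬ r u u)
    [DecidableRel r] {B : Finset V} {y : V} (hy : y ∉ B) (k : ℕ) :
    (cliques r (insert y B) (k + 1)).card =
      (cliques r B (k + 1)).card + (cliques r (B.filter (r y)) k).card := by
  convert cliques_card_insert hr hy (N := B.filter (r y)) (fun u => ?_) k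
  rw [Finset.mem_filter, Finset.mem_insert]
  refine ⟨fun h => ⟨Or.inr h.1, h.2⟩, fun h => ⟨h.1.resolve_left ?_, h.2⟩⟩
  rintro rfl
  exact hi _ h.2

theorem cliques_withFree_insert (hr : ∀ u v, r u v → r v u) (hi : ∀ u, ¬ r u u)
    [DecidableRel r] {Z B : Finset V} {y : V} (hy : y ∉ B) (hZ : y ∉ Z) (k : ℕ) :
    (cliques (withFree r Z) (Z ∪ insert y B) (k + 1)).card =
      (cliques (withFree r Z) (Z ∪ B) (k + 1)).card +
        (cliques (withFree r Z) (Z ∪ B.filter (r y)) k).card := by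
  rw [Finset.union_insert]
  convert cliques_card_insert (withFree_symm hr Z) (A := Z ∪ B) (N := Z ∪ B.filter (r y)) (a := y)
    (by simp [hy, hZ]) (fun u => ?_) k
  simp only [Finset.mem_union, Finset.mem_filter, Finset.mem_insert, withFree]
  constructor
  · rintro (h | h)
    · exact ⟨Or.inr (Or.inl h), Or.inr (Or.inl h)⟩
    · exact ⟨Or.inr (Or.inr h.1), Or.inr (Or.inr h.2)⟩
  · rintro ⟨h1, h2 | h2 | h2⟩
    · exact (hZ h2).elim
    · exact Or.inl h2
    · rcases h1 with rfl | h1 | h1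
      · exact (hi _ h2).elim
      · exact Or.inl h1
      · exact Or.inr ⟨h1, h2⟩

/-- The terms sort the pairs by the number of members in `Z`, where repetition is allowed. -/
theorem cliques_withFree_two (hr : ∀ u v, r u v → r v u) (hi : ∀ u, ¬ r u u)
    {Z B : Finset V} (hZ : Disjoint Z B) :
    2 * (cliques (withFree r Z) (Z ∪ B) 2).card =
      Z.card * (Z.card + 1) + 2 * Z.card * B.card + 2 * (cliques r B 2).card := by
  classical
  induction B using Finset.induction_on with
  | empty =>
    rw [Finset.union_empty, (cliques_card_complete (withFree_symm hr Z) Z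
      fun u hu v _ => Or.inl hu).1, ← Nat.mul_left_cancel_iff two_pos, (cliques_card_complete hr ∅
      fun u hu => by simp at hu).1]
    simp
  | insert y B hy ih =>
    rw [Finset.disjoint_insert_right] at hZ
    have ih := ih hZ.2
    rw [cliques_withFree_insert hr hi hy hZ.1, cliques_card_insert_of_irrefl hr hi hy,
      cliques_card_one, cliques_card_one, Finset.card_union_of_disjoint
        (Finset.disjoint_of_subset_right (Finset.filter_subset _ _) hZ.2),
      Finset.card_insert_of_notMem hy]
    linear_combination ih

theorem cliques_withFree_three (hr : ∀ u v, r u v → r v u) (hi : ∀ u, ¬ r u u)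
    {Z B : Finset V} (hZ : Disjoint Z B) :
    6 * (cliques (withFree r Z) (Z ∪ B) 3).card =
      Z.card * (Z.card + 1) * (Z.card + 2) + 3 * Z.card * (Z.card + 1) * B.card +
        6 * Z.card * (cliques r B 2).card + 6 * (cliques r B 3).card := by
  classical
  induction B using Finset.induction_on with
  | empty =>
    have h := cliques_card_complete hr ∅ fun u hu => by simp at hu
    rw [Finset.union_empty, (cliques_card_complete (withFree_symm hr Z) Z
      fun u hu v _ => Or.inl hu).2]
    rw [Finset.card_empty] at *
    have h2 : (cliques r ∅ 2).card = 0 := by omega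
    have h3 : (cliques r ∅ 3).card = 0 := by omega
    simp [h2, h3]
  | insert y B hy ih =>
    rw [Finset.disjoint_insert_right] at hZ
    have ih := ih hZ.2
    have h2 := cliques_withFree_two hr hi
        (Finset.disjoint_of_subset_right (Finset.filter_subset (r y) _) hZ.2)
    rw [cliques_withFree_insert hr hi hy hZ.1, cliques_card_insert_of_irrefl hr hi hy,
      cliques_card_insert_of_irrefl hr hi hy, cliques_card_one, Finset.card_insert_of_notMem hy]
    -- The new triples are `y` times a pair on `Z` and the relatives of `y`, which `h2` counts.
    linear_combination ih + 3 * h2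

theorem cliques_pairwise (hr : ∀ u v, r u v → r v u) (hi : ∀ u, ¬ r u u) {R : Finset V}
    (hR : ∀ u ∈ R, ∀ v ∈ R, u ≠ v → r u v) :
    2 * ((cliques r R 2).card : ℤ) = R.card * (R.card - 1) ∧
    6 * ((cliques r R 3).card : ℤ) = R.card * (R.card - 1) * (R.card - 2) := by
  classical
  induction R using Finset.induction_on with
  | empty =>
    have h := cliques_card_complete hr ∅ fun u hu => by simp at hu
    rw [Finset.card_empty] at *
    have h2 : (cliques r ∅ 2).card = 0 := by omega
    have h3 : (cliques r ∅ 3).card = 0 := by omega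
    simp [h2, h3]
  | insert y R hy ih =>
    obtain ⟨ih2, ih3⟩ := ih fun u hu v hv => hR u (by simp [hu]) v (by simp [hv])
    have hf : R.filter (r y) = R := Finset.filter_true_of_mem fun u hu =>
      hR y (by simp) u (by simp [hu]) (by rintro rfl; exact hy hu)
    rw [cliques_card_insert_of_irrefl hr hi hy, cliques_card_insert_of_irrefl hr hi hy,
      hf, cliques_card_one, Finset.card_insert_of_notMem hy]
    push_cast
    constructor
    · linear_combination ih2
    · linear_combination ih3 + 3 * ih2

theorem filter_union_eq [DecidableRel r] {R B : Finset V} {y : V} {ρ : V → V}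
    (hy : ∀ u ∈ R, r y u ↔ u ≠ ρ y) :
    (R ∪ B).filter (r y) = R.erase (ρ y) ∪ B.filter (r y) := by
  ext u
  simp only [Finset.mem_filter, Finset.mem_union, Finset.mem_erase]
  constructor
  · rintro ⟨h | h, h'⟩
    · exact Or.inl ⟨(hy u h).1 h', h⟩
    · exact Or.inr ⟨h, h'⟩
  · rintro (⟨h', h⟩ | ⟨h, h'⟩)
    · exact ⟨Or.inl h, (hy u h).2 h'⟩
    · exact ⟨Or.inr h, h'⟩

/-- Here `ρ b` is the representative of the class of `b`, the only element of `R` not related to it;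
this gives the factor `R.card - 1`. -/
theorem cliques_transversal_two (hr : ∀ u v, r u v → r v u) (hi : ∀ u, ¬ r u u)
    {R B : Finset V} (hR : ∀ u ∈ R, ∀ v ∈ R, u ≠ v → r u v) (hd : Disjoint R B) (ρ : V → V)
    (hρ : ∀ b ∈ B, ρ b ∈ R ∧ ∀ u ∈ R, r b u ↔ u ≠ ρ b) :
    2 * ((cliques r (R ∪ B) 2).card : ℤ) =
      R.card * (R.card - 1) + 2 * (R.card - 1) * B.card + 2 * (cliques r B 2).card := by
  classical
  induction B using Finset.induction_on with
  | empty =>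
    have h := (cliques_card_complete hr ∅ fun u hu => by simp at hu).1
    rw [Finset.card_empty] at h
    have h2 : (cliques r ∅ 2).card = 0 := by omega
    rw [Finset.union_empty, (cliques_pairwise hr hi hR).1]
    simp [h2]
  | insert y B hy ih =>
    rw [Finset.disjoint_insert_right] at hd
    have ih := ih hd.2 fun b hb => hρ b (by simp [hb])
    have hρy := hρ y (by simp)
    have hpos : 1 ≤ R.card := Finset.card_pos.2 ⟨_, hρy.1⟩
    rw [Finset.union_insert, cliques_card_insert_of_irrefl hr hi (by simp [hy, hd.1]),
      cliques_card_insert_of_irrefl hr hi hy, filter_union_eq hρy.2,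
      cliques_card_one, cliques_card_one, Finset.card_union_of_disjoint
        (Finset.disjoint_of_subset_right (Finset.filter_subset _ _)
          (Finset.disjoint_of_subset_left (Finset.erase_subset _ _) hd.2)),
      Finset.card_erase_of_mem hρy.1, Finset.card_insert_of_notMem hy]
    push_cast [Nat.cast_sub hpos]
    linear_combination ih

theorem cliques_transversal_three (hr : ∀ u v, r u v → r v u) (hi : ∀ u, ¬ r u u)
    {R B : Finset V} (hR : ∀ u ∈ R, ∀ v ∈ R, u ≠ v → r u v) (hd : Disjoint R B) (ρ : V → V)
    (hρ : ∀ b ∈ B, ρ b ∈ R ∧ ∀ u ∈ R, r b u ↔ u ≠ ρ b)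
    (hρ' : ∀ b ∈ B, ∀ b' ∈ B, r b b' → ρ b ≠ ρ b') :
    6 * ((cliques r (R ∪ B) 3).card : ℤ) =
      R.card * (R.card - 1) * (R.card - 2) + 3 * (R.card - 1) * (R.card - 2) * B.card +
        6 * (R.card - 2) * (cliques r B 2).card + 6 * (cliques r B 3).card := by
  classical
  induction B using Finset.induction_on with
  | empty =>
    have h := cliques_card_complete hr ∅ fun u hu => by simp at hu
    rw [Finset.card_empty] at h
    have h2 : (cliques r ∅ 2).card = 0 := by omega
    have h3 : (cliques r ∅ 3).card = 0 := by omega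
    rw [Finset.union_empty, (cliques_pairwise hr hi hR).2]
    simp [h2, h3]
  | insert y B hy ih =>
    rw [Finset.disjoint_insert_right] at hd
    have ih := ih hd.2 (fun b hb => hρ b (by simp [hb]))
      fun b hb b' hb' => hρ' b (by simp [hb]) b' (by simp [hb'])
    have hρy := hρ y (by simp)
    have hpos : 1 ≤ R.card := Finset.card_pos.2 ⟨_, hρy.1⟩
    -- The relatives of `y` have the same structure with `R` shortened by `ρ y`: by `hρ'`, they keep
    -- their own representatives.
    have h2 := cliques_transversal_two hr hi (R := R.erase (ρ y)) (B := B.filter (r y))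
      (fun u hu v hv => hR u (Finset.mem_of_mem_erase hu) v (Finset.mem_of_mem_erase hv))
      (Finset.disjoint_of_subset_right (Finset.filter_subset _ _)
          (Finset.disjoint_of_subset_left (Finset.erase_subset _ _) hd.2)) ρ (by
        intro b hb
        rw [Finset.mem_filter] at hb
        obtain ⟨h1, h2⟩ := hρ b (by simp [hb.1])
        refine ⟨Finset.mem_erase.2 ⟨(hρ' y (by simp) b (by simp [hb.1]) hb.2).symm, h1⟩, ?_⟩
        exact fun u hu => h2 u (Finset.mem_of_mem_erase hu))
    rw [Finset.union_insert, cliques_card_insert_of_irrefl hr hi (by simp [hy, hd.1]),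
      cliques_card_insert_of_irrefl hr hi hy, cliques_card_insert_of_irrefl hr hi hy,
      filter_union_eq hρy.2, cliques_card_one, Finset.card_insert_of_notMem hy]
    rw [Finset.card_erase_of_mem hρy.1] at h2
    push_cast [Nat.cast_sub hpos] at h2 ⊢
    linear_combination ih + 3 * h2

end Counting

/-! ### Bounds on numbers of pairs -/

section Counting

variable {V : Type*} [DecidableEq V] {r : V → V → Prop}

theorem cliques_two_union_le (hr : ∀ u v, r u v → r v u) (hi : ∀ u, ¬ r u u) {L C : Finset V}
    (hd : Disjoint L C) :
    (cliques r (L ∪ C) 2).card ≤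
      (cliques r L 2).card + L.card * C.card + (cliques r C 2).card := by
  classical
  induction C using Finset.induction_on with
  | empty => simp
  | insert y C hy ih =>
    rw [Finset.disjoint_insert_right] at hd
    have ih := ih hd.2
    rw [Finset.union_insert, cliques_card_insert_of_irrefl hr hi (by simp [hy, hd.1]),
      cliques_card_insert_of_irrefl hr hi hy, cliques_card_one, cliques_card_one,
      Finset.card_insert_of_notMem hy, Finset.filter_union]
    have h1 := Finset.card_union_le (L.filter (r y)) (C.filter (r y))
    have h2 := Finset.card_filter_le L (r y)
    simp only [Nat.reduceAdd, mul_add, mul_one]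
    omega

theorem mul_le_cliques_two (hr : ∀ u v, r u v → r v u) (hi : ∀ u, ¬ r u u) {P N : Finset V}
    (h : ∀ u ∈ P, ∀ v ∈ N, r u v) : P.card * N.card ≤ (cliques r (P ∪ N) 2).card := by
  classical
  induction P using Finset.induction_on with
  | empty => simp
  | insert y P hy ih =>
    have ih := ih fun u hu => h u (by simp [hu])
    have hyN : y ∉ N := fun h' => hi y (h y (by simp) y h')
    rw [Finset.insert_union, cliques_card_insert_of_irrefl hr hi (by simp [hy, hyN]),
      cliques_card_one, Finset.card_insert_of_notMem hy]
    have : N.card ≤ ((P ∪ N).filter (r y)).card := Finset.card_le_card fun v hv =>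
      Finset.mem_filter.2 ⟨Finset.mem_union_right _ hv, h y (by simp) v hv⟩
    simp only [Nat.reduceAdd, add_mul, one_mul]
    omega

end Counting

/-! ### The inequality h₀ - h₁ + h₂ ≤ h₃ without coloops -/

namespace FaceComplex

variable {V : Type*} [DecidableEq V] {Δ : FaceComplex V} [Fintype V]

theorem IsMatroidComplex.mul_le_pairs (hΔ : Δ.IsMatroidComplex) [DecidableRel Δ.Npar]
    {W : Finset V} (hW : W ⊆ Δ.nonloops) (x : V) :
    (W.filter fun y => ¬ Δ.Npar x y).card * (W.filter (Δ.Npar x)).card ≤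
      (cliques Δ.Npar W 2).card := by
  have := mul_le_cliques_two Δ.npar_comm (fun _ => npar_irrefl)
    (P := W.filter fun y => ¬ Δ.Npar x y) (N := W.filter (Δ.Npar x)) (by
      intro u hu v hv
      rw [Finset.mem_filter] at hu hv
      exact (hΔ.npar_or_npar (mem_nonloops.1 (hW hu.1)) hv.2).resolve_left fun h => hu.2 h.symm)
  rwa [Finset.union_comm, Finset.filter_union_filter_not_eq] at this

open Classical in
/-- Faces with three elements, counted by the number of elements they have in `L`. -/
theorem pairs_mul_add_le_faceCount_three {L C : Finset V} (hd : Disjoint L C) {w : ℕ}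
    (h₁ : ∀ F ∈ Δ, F.card = 2 → F ⊆ L → ∀ c ∈ C, insert c F ∈ Δ)
    (h₂ : ∀ F ∈ Δ, F.card = 2 → F ⊆ C → w ≤ (L.filter fun x => insert x F ∈ Δ).card) :
    (cliques Δ.Npar L 2).card * C.card + (cliques Δ.Npar C 2).card * w ≤ Δ.faceCount 3 := by
  rw [← card_filter_faces_two, ← card_filter_faces_two]
  set P := Δ.faces.filter fun F => F.card = 2 ∧ F ⊆ L with hP
  set Q := Δ.faces.filter fun F => F.card = 2 ∧ F ⊆ C with hQ
  have hPm : ∀ F, F ∈ P ↔ F ∈ Δ ∧ F.card = 2 ∧ F ⊆ L := fun F => by simp [hP, mem_faces]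
  have hQm : ∀ F, F ∈ Q ↔ F ∈ Δ ∧ F.card = 2 ∧ F ⊆ C := fun F => by simp [hQ, mem_faces]
  -- The two parts of `insert x F` recover `F` and `x`. Hence both families below are injectively
  -- parametrised, and they are disjoint by the size of the part in `C`.
  have key : ∀ (A B F : Finset V) (x : V), Disjoint A B → F ⊆ A → x ∈ B →
      insert x F ∩ A = F ∧ insert x F ∩ B = {x} ∧ x ∉ F := by
    intro A B F x hAB hF hx
    have hxA : x ∉ A := fun h => Finset.disjoint_left.1 hAB h hx
    refine ⟨?_, ?_, fun h => hxA (hF h)⟩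
    · rw [Finset.insert_inter_of_notMem hxA, Finset.inter_eq_left.2 hF]
    · rw [Finset.insert_inter_of_mem hx, Finset.disjoint_iff_inter_eq_empty.1
        (Finset.disjoint_of_subset_left hF hAB)]
      rfl
  let T₁ := (P ×ˢ C).image fun p => insert p.2 p.1
  let T₂ := (Q.sigma fun F => L.filter fun x => insert x F ∈ Δ).image fun p => insert p.2 p.1
  have c₁ : T₁.card = P.card * C.card := by
    rw [Finset.card_image_of_injOn, Finset.card_product]
    rintro ⟨F, c⟩ hF ⟨G, d⟩ hG heq
    simp only [Finset.coe_product, Set.mem_prod, Finset.mem_coe, hPm] at hF hG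
    obtain ⟨e1, e2, -⟩ := key L C F c hd hF.1.2.2 hF.2
    obtain ⟨e1', e2', -⟩ := key L C G d hd hG.1.2.2 hG.2
    simp only at heq
    rw [heq] at e1 e2
    rw [← e1, e1', Prod.mk.injEq]
    exact ⟨rfl, Finset.singleton_injective (e2.symm.trans e2')⟩
  have c₂ : Q.card * w ≤ T₂.card := by
    rw [Finset.card_image_of_injOn, Finset.card_sigma]
    · rw [← smul_eq_mul]
      refine Finset.card_nsmul_le_sum _ _ _ fun F hF => ?_
      rw [hQm] at hF
      exact h₂ F hF.1 hF.2.1 hF.2.2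
    · rintro ⟨F, c⟩ hF ⟨G, d⟩ hG heq
      simp only [Finset.coe_sigma, Set.mem_sigma_iff, Finset.mem_coe, hQm, Finset.mem_filter]
        at hF hG
      obtain ⟨e1, e2, -⟩ := key C L F c hd.symm hF.1.2.2 hF.2.1
      obtain ⟨e1', e2', -⟩ := key C L G d hd.symm hG.1.2.2 hG.2.1
      simp only at heq
      rw [heq] at e1 e2
      have h1 : F = G := e1.symm.trans e1'
      have h2 : c = d := Finset.singleton_injective (e2.symm.trans e2')
      rw [h1, h2]
  have hdisj : Disjoint T₁ T₂ := by
    rw [Finset.disjoint_left]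
    intro T hT1 hT2
    obtain ⟨⟨F, c⟩, hF, rfl⟩ := Finset.mem_image.1 hT1
    obtain ⟨⟨G, d⟩, hG, heq⟩ := Finset.mem_image.1 hT2
    simp only [Finset.mem_product, Finset.mem_sigma, Finset.mem_filter, hPm, hQm] at hF hG heq
    obtain ⟨e1, -, -⟩ := key L C F c hd hF.1.2.2 hF.2
    obtain ⟨-, e2, -⟩ := key C L G d hd.symm hG.1.2.2 hG.2.1
    rw [heq, e1] at e2
    have := hF.1.2.1
    rw [e2] at this
    simp at this
  calc P.card * C.card + Q.card * w ≤ T₁.card + T₂.card := by omega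
    _ = (T₁ ∪ T₂).card := (Finset.card_union_of_disjoint hdisj).symm
    _ ≤ Δ.faceCount 3 := by
      refine Finset.card_le_card fun T hT => ?_
      rw [Finset.mem_filter, mem_faces]
      rcases Finset.mem_union.1 hT with hT | hT
      · obtain ⟨⟨F, c⟩, hF, rfl⟩ := Finset.mem_image.1 hT
        simp only [Finset.mem_product, hPm] at hF ⊢
        refine ⟨h₁ F hF.1.1 hF.1.2.1 hF.1.2.2 c hF.2, ?_⟩
        rw [Finset.card_insert_of_notMem (key L C F c hd hF.1.2.2 hF.2).2.2, hF.1.2.1]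
      · obtain ⟨⟨F, c⟩, hF, rfl⟩ := Finset.mem_image.1 hT
        simp only [Finset.mem_sigma, Finset.mem_filter, hQm] at hF ⊢
        refine ⟨hF.2.2, ?_⟩
        rw [Finset.card_insert_of_notMem (key C L F c hd.symm hF.1.2.2 hF.2.1).2.2, hF.1.2.1]

namespace IsMatroidComplex

/-- The pairs on a line extend to bases by every point off it; if the pairs off it extend to bases
by at least `w` points of the line, this bounds the number of bases from below. -/
theorem line_mul_le (hΔ : Δ.IsMatroidComplex) {a b : V} (hab : Δ.Npar a b) {w : ℕ}
    (h : open Classical in ∀ F ∈ Δ, F.card = 2 → F ⊆ Δ.nonloops \ Δ.line a b →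
      w ≤ ((Δ.line a b).filter fun x => insert x F ∈ Δ).card) :
    (cliques Δ.Npar (Δ.line a b) 2).card * (Δ.nonloops \ Δ.line a b).card +
      (cliques Δ.Npar (Δ.nonloops \ Δ.line a b) 2).card * w ≤ Δ.faceCount 3 := by
  refine pairs_mul_add_le_faceCount_three Finset.disjoint_sdiff ?_ h
  intro F hF hF2 hFL c hc
  obtain ⟨x, y, hxy, rfl⟩ := Finset.card_eq_two.1 hF2
  rw [Finset.mem_sdiff] at hc
  exact hΔ.mem_of_mem_line hab (hFL (by simp)) (hFL (by simp)) ⟨hxy, hF⟩ hc.1 hc.2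

/-- If at most one element `c` were off the line, a basis avoiding `c` would lie on the line. -/
theorem two_le_card_off_line (hΔ : Δ.IsMatroidComplex)
    (hco : ∀ x, ∃ B ∈ Δ, B.card = 3 ∧ x ∉ B) {a b : V} (hab : Δ.Npar a b) :
    2 ≤ (Δ.nonloops \ Δ.line a b).card := by
  by_contra! hlt
  obtain ⟨c, hc⟩ : ∃ c, Δ.nonloops \ Δ.line a b ⊆ {c} := by
    have : Nonempty V := ⟨a⟩
    exact Finset.card_le_one_iff_subset_singleton.1 (by omega)
  obtain ⟨B, hB, hB3, hcB⟩ := hco c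
  have := hΔ.card_le_two_of_subset_line hab hB (by
    intro x hx
    by_contra hxl
    have := hc (Finset.mem_sdiff.2 ⟨subset_nonloops hB hx, hxl⟩)
    rw [Finset.mem_singleton] at this
    exact hcB (this ▸ hx))
  omega

theorem faceCount_two_le_line (a b : V) :
    Δ.faceCount 2 ≤ (cliques Δ.Npar (Δ.line a b) 2).card +
      (Δ.line a b).card * (Δ.nonloops \ Δ.line a b).card +
        (cliques Δ.Npar (Δ.nonloops \ Δ.line a b) 2).card := by
  have := cliques_two_union_le Δ.npar_comm (fun _ => npar_irrefl)
    (L := Δ.line a b) (C := Δ.nonloops \ Δ.line a b) Finset.disjoint_sdiff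
  rwa [Finset.union_sdiff_of_subset (line_subset a b), ← faceCount_two] at this

end IsMatroidComplex

open Classical in
/-- A line in which no parallel class is the complement of at most one element. -/
def IsWide (Δ : FaceComplex V) (L : Finset V) : Prop :=
  ∀ x ∈ Δ.nonloops, 2 ≤ (L.filter (Δ.Npar x)).card

namespace IsMatroidComplex

-- If a parallel class meets `L` in α ≥ 2 elements, leaving β ≥ 2 others, there are at least αβ
-- pairs and (α - 2)(β - 2) ≥ 0. Otherwise all pairs in `L` occur, and a quadratic inequality in
-- `L.card` remains.
open Classical in
theorem le_pairs_of_isWide (hΔ : Δ.IsMatroidComplex) {L : Finset V} (hL : L ⊆ Δ.nonloops)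
    (h : Δ.IsWide L) : 2 * L.card ≤ (cliques Δ.Npar L 2).card + 4 := by
  by_cases hx : ∃ x ∈ L, 2 ≤ (L.filter fun y => ¬ Δ.Npar x y).card
  · obtain ⟨x, hxL, hx⟩ := hx
    have h1 := hΔ.mul_le_pairs hL x
    have h2 := h x (hL hxL)
    have h3 := Finset.card_filter_add_card_filter_not (s := L) (Δ.Npar x)
    nlinarith
  · push Not at hx
    have h1 := (cliques_pairwise Δ.npar_comm (fun _ => npar_irrefl) (R := L) (by
      intro u hu v hv huv
      by_contra hn
      refine (hx u hu).not_ge (Finset.one_lt_card.2 ⟨u, ?_, v, ?_, huv⟩)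
      · simp [hu, npar_irrefl]
      · simp [hv, hn])).1
    zify
    nlinarith [sq_nonneg ((L.card : ℤ) * 2 - 5)]

theorem bound_of_isWide (hΔ : Δ.IsMatroidComplex)
    (hco : ∀ x, ∃ B ∈ Δ, B.card = 3 ∧ x ∉ B) {a b : V} (hab : Δ.Npar a b)
    (h : Δ.IsWide (Δ.line a b)) :
    2 * Δ.faceCount 2 + 8 ≤ Δ.faceCount 3 + 4 * Δ.nonloops.card := by
  classical
  have h1 := hΔ.line_mul_le hab (w := 2) (by
    intro F hF hF2 hFC
    obtain ⟨c, d, hcd, rfl⟩ := Finset.card_eq_two.1 hF2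
    -- If some `x` on the line fails to complete `{c, d}` to a basis, every element of the line not
    -- parallel to `x` does complete it.
    by_cases hx : ∃ x ∈ Δ.line a b, insert x {c, d} ∉ Δ
    · obtain ⟨x, hxl, hx⟩ := hx
      refine (h x (line_subset _ _ hxl)).trans (Finset.card_le_card fun y hy => ?_)
      rw [Finset.mem_filter] at *
      refine ⟨hy.1, ?_⟩
      have hc := hFC (show c ∈ {c, d} by simp)
      rw [Finset.mem_sdiff] at hc
      exact (hΔ.mem_or_mem_of_npar hab hxl hy.1 hy.2 hc.2 ⟨hcd, hF⟩).resolve_left hx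
    · push Not at hx
      rw [Finset.filter_true_of_mem hx]
      exact (h a (mem_nonloops.2 hab.left)).trans (Finset.card_filter_le _ _))
  have h2 := faceCount_two_le_line (Δ := Δ) a b
  have h3 := hΔ.two_le_card_off_line hco hab
  have h4 := hΔ.le_pairs_of_isWide (line_subset a b) h
  have h5 := Finset.card_sdiff_add_card_eq_card (line_subset (Δ := Δ) a b)
  generalize (Δ.nonloops \ Δ.line a b).card = k at *
  generalize (Δ.line a b).card = l at *
  obtain ⟨k, rfl⟩ := Nat.exists_eq_add_of_le h3
  -- With p pairs on the line, the difference of the two sides is at least k(p + 4 - 2l), where `k`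
  -- is now the excess over 2 off the line; pairs off the line cancel.
  nlinarith [Nat.mul_le_mul_left k h4]

/-- A line with three pairwise non-parallel elements is wide, because any non-loop is parallel to at
most one of them. -/
theorem mem_of_forall_not_isWide (hΔ : Δ.IsMatroidComplex)
    (hbad : ∀ a b, Δ.Npar a b → ¬ Δ.IsWide (Δ.line a b)) {x y z : V} (hxy : Δ.Npar x y)
    (hxz : Δ.Npar x z) (hyz : Δ.Npar y z) : ({z, x, y} : Finset V) ∈ Δ := by
  classical
  by_contra hn
  have hz : z ∈ Δ.line x y := mem_line.2 ⟨mem_nonloops.2 hxz.right, fun h => hn h.2.2⟩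
  have hx := left_mem_line hxy
  have hy := right_mem_line hxy
  refine hbad x y hxy fun u hu => ?_
  have hu := mem_nonloops.1 hu
  have key : ∀ p ∈ Δ.line x y, ∀ q ∈ Δ.line x y, Δ.Npar u p → Δ.Npar u q → p ≠ q →
      2 ≤ ((Δ.line x y).filter (Δ.Npar u)).card := fun p hp q hq hup huq hpq =>
    Finset.one_lt_card.2 ⟨p, by simp [hp, hup], q, by simp [hq, huq], hpq⟩
  rcases hΔ.npar_or_npar hu hxy with h1 | h1
  · rcases hΔ.npar_or_npar hu hyz with h2 | h2
    · exact key x hx y hy h1 h2 hxy.1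
    · exact key x hx z hz h1 h2 hxz.1
  · rcases hΔ.npar_or_npar hu hxz with h2 | h2
    · exact key x hx y hy h2 h1 hxy.1
    · exact key y hy z hz h1 h2 hyz.1

/-- If no line is wide, there is a line off which no two elements are parallel. -/
theorem exists_line_of_forall_not_isWide (hΔ : Δ.IsMatroidComplex)
    (hbad : ∀ a b, Δ.Npar a b → ¬ Δ.IsWide (Δ.line a b)) (hne : ∃ a b, Δ.Npar a b) :
    ∃ a b, Δ.Npar a b ∧ ∀ c ∈ Δ.nonloops \ Δ.line a b, ∀ d ∈ Δ.nonloops \ Δ.line a b,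
      c ≠ d → Δ.Npar c d := by
  classical
  obtain ⟨a, b, hab⟩ := hne
  by_cases hp : ∃ u ∈ Δ.nonloops, ∃ v ∈ Δ.nonloops, u ≠ v ∧ ¬ Δ.Npar u v
  · obtain ⟨u, hu, v, hv, huv, hn⟩ := hp
    obtain ⟨w, hw⟩ : ∃ w, Δ.Npar u w := by
      rcases hΔ.npar_or_npar (mem_nonloops.1 hu) hab with h | h
      · exact ⟨a, h⟩
      · exact ⟨b, h⟩
    have hvl : ∀ w, v ∈ Δ.line u w := fun w => mem_line.2
      ⟨hv, fun h => hn (npar_of_mem h.2.2 (by simp) (by simp) huv)⟩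
    refine ⟨u, w, hw, fun c hc d hd hcd => ?_⟩
    by_contra hncd
    rw [Finset.mem_sdiff] at hc hd
    have huc := (hΔ.npar_of_notMem_line hw (left_mem_line hw) hc.1 hc.2).symm
    have hdl : d ∈ Δ.line u c := mem_line.2
      ⟨hd.1, fun h => hncd (npar_of_mem h.2.2 (by simp) (by simp) hcd)⟩
    -- The line through `u` and `c` contains the parallel pairs `{u, v}` and `{c, d}` from different
    -- classes. Any `y` is non-parallel to both members of one of them, so this line is wide.
    refine hbad u c huc fun y hy => ?_
    rcases hΔ.npar_or_npar (mem_nonloops.1 hy) huc with h | h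
    · have h' : Δ.Npar y v := ((hΔ.npar_or_npar (mem_nonloops.1 hv) h).resolve_right
        fun h => hn h.symm).symm
      exact Finset.one_lt_card.2 ⟨u, by simp [left_mem_line huc, h], v, by simp [hvl, h'], huv⟩
    · have h' : Δ.Npar y d := ((hΔ.npar_or_npar (mem_nonloops.1 hd.1) h).resolve_right
        fun h => hncd h.symm).symm
      exact Finset.one_lt_card.2 ⟨c, by simp [right_mem_line huc, h], d, by simp [hdl, h'], hcd⟩
  · push Not at hp
    exact ⟨a, b, hab, fun c hc d hd => hp c (Finset.mem_sdiff.1 hc).1 d (Finset.mem_sdiff.1 hd).1⟩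

theorem bound_of_forall_not_isWide (hΔ : Δ.IsMatroidComplex)
    (hco : ∀ x, ∃ B ∈ Δ, B.card = 3 ∧ x ∉ B)
    (hbad : ∀ a b, Δ.Npar a b → ¬ Δ.IsWide (Δ.line a b)) (hne : ∃ a b, Δ.Npar a b) :
    2 * Δ.faceCount 2 + 8 ≤ Δ.faceCount 3 + 4 * Δ.nonloops.card := by
  classical
  obtain ⟨a, b, hab, hC⟩ := hΔ.exists_line_of_forall_not_isWide hbad hne
  -- Every element of the line completes every pair off it: the three elements are pairwise
  -- non-parallel, which suffices when no line is wide.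
  have h1 := hΔ.line_mul_le hab (w := (Δ.line a b).card) (by
    intro F hF hF2 hFC
    obtain ⟨c, d, hcd, rfl⟩ := Finset.card_eq_two.1 hF2
    rw [Finset.filter_true_of_mem]
    intro x hx
    have hc := hFC (show c ∈ {c, d} by simp)
    have hd := hFC (show d ∈ {c, d} by simp)
    rw [Finset.mem_sdiff] at hc hd
    exact hΔ.mem_of_forall_not_isWide hbad ⟨hcd, hF⟩ (hΔ.npar_of_notMem_line hab hx hc.1 hc.2)
      (hΔ.npar_of_notMem_line hab hx hd.1 hd.2))
  have h2 := faceCount_two_le_line (Δ := Δ) a b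
  have h3 := hΔ.two_le_card_off_line hco hab
  have h4 := hΔ.mul_le_pairs (line_subset a b) a
  have h5 := Finset.card_sdiff_add_card_eq_card (line_subset (Δ := Δ) a b)
  have h6 := Finset.card_filter_add_card_filter_not (s := Δ.line a b) (Δ.Npar a)
  have h7 : 1 ≤ ((Δ.line a b).filter (Δ.Npar a)).card :=
    Finset.card_pos.2 ⟨b, by simp [right_mem_line hab, hab]⟩
  have h8 : 1 ≤ ((Δ.line a b).filter fun y => ¬ Δ.Npar a y).card :=
    Finset.card_pos.2 ⟨a, by simp [left_mem_line hab, npar_irrefl]⟩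
  have h9 := (cliques_pairwise Δ.npar_comm (fun _ => npar_irrefl) hC).1
  generalize (Δ.nonloops \ Δ.line a b).card = k at *
  generalize ((Δ.line a b).filter (Δ.Npar a)).card = β at *
  generalize ((Δ.line a b).filter fun y => ¬ Δ.Npar a y).card = α at *
  obtain ⟨k, rfl⟩ := Nat.exists_eq_add_of_le h3
  obtain ⟨α, rfl⟩ := Nat.exists_eq_add_of_le h8
  obtain ⟨β, rfl⟩ := Nat.exists_eq_add_of_le h7
  generalize (cliques Δ.Npar (Δ.line a b) 2).card = p at *
  generalize (cliques Δ.Npar (Δ.nonloops \ Δ.line a b) 2).card = q at *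
  -- With the shifted α and β, the line has (1 + α)(1 + β) pairs or more; expanding gives this
  -- bound.
  have hp : 1 + α + β ≤ p := by nlinarith
  have hq : 1 + k ≤ q := by
    zify
    push_cast at h9
    nlinarith
  rw [← h6] at h1 h2 h5
  obtain ⟨p, rfl⟩ := Nat.exists_eq_add_of_le hp
  obtain ⟨q, rfl⟩ := Nat.exists_eq_add_of_le hq
  rw [← h5]
  nlinarith [Nat.zero_le (p * k), Nat.zero_le (q * α), Nat.zero_le (q * β)]

/-- The inequality `h₀ - h₁ + h₂ ≤ h₃` for a matroid complex of rank three without coloops. -/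
theorem two_mul_faceCount_two_le (hΔ : Δ.IsMatroidComplex)
    (hco : ∀ x, ∃ B ∈ Δ, B.card = 3 ∧ x ∉ B) (hne : ∃ a b, Δ.Npar a b) :
    2 * Δ.faceCount 2 + 8 ≤ Δ.faceCount 3 + 4 * Δ.nonloops.card := by
  by_cases h : ∃ a b, Δ.Npar a b ∧ Δ.IsWide (Δ.line a b)
  · obtain ⟨a, b, hab, h⟩ := h
    exact hΔ.bound_of_isWide hco hab h
  · push Not at h
    exact hΔ.bound_of_forall_not_isWide hco h hne

end IsMatroidComplex

end FaceComplex

/-! ### Covering pairs by triples through a free element -/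

section Cover

variable {V : Type*} [DecidableEq V]

/-- If `z` is related to everything, few 3-cliques containing `z` suffice to cover all pairs. -/
theorem exists_cover {c : V → V → Prop} (hc : ∀ u v, c u v → c v u) {A : Finset V} {z : V}
    (hz : z ∈ A) (hzc : ∀ u, c z u) (h : ∀ v ∈ A.erase z, ∃ w ∈ A.erase z, c v w) :
    ∃ C ⊆ cliques c A 3, C.card + A.card ≤ (cliques c A 2).card + 1 ∧
      ∀ P ∈ cliques c A 2, ∃ Q ∈ C, P ≤ Q := by
  have hN : ∀ u, u ∈ A ↔ u ∈ insert z (A.erase z) ∧ c z u := fun u => by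
    rw [Finset.insert_erase hz]
    exact ⟨fun h => ⟨h, hzc u⟩, fun h => h.1⟩
  have hcard := cliques_card_insert hc (Finset.notMem_erase z A) hN 1
  rw [Finset.insert_erase hz, cliques_card_one] at hcard
  have hmem : ∀ u v, u ∈ A → v ∈ A → u ≠ z → v ≠ z → c u v →
      z ::ₘ {u, v} ∈ (cliques c (A.erase z) 2).image (Multiset.cons z) := fun u v hu hv huz hvz huv =>
    Finset.mem_image_of_mem _ ((pair_mem_cliques hc).2
      ⟨Finset.mem_erase.2 ⟨huz, hu⟩, Finset.mem_erase.2 ⟨hvz, hv⟩, huv⟩)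
  have hzu : ∀ u ∈ A, ∃ Q ∈ insert {z, z, z} ((cliques c (A.erase z) 2).image (Multiset.cons z)),
      {z, u} ≤ Q := by
    intro u hu
    by_cases huz : u = z
    · subst huz
      exact ⟨_, Finset.mem_insert_self _ _, Multiset.le_cons_self _ _⟩
    · obtain ⟨w, hw, huw⟩ := h u (Finset.mem_erase.2 ⟨huz, hu⟩)
      rw [Finset.mem_erase] at hw
      refine ⟨_, Finset.mem_insert_of_mem (hmem u w hu hw.2 huz hw.1 huw), ?_⟩
      exact (Multiset.cons_le_cons_iff z).2 (Multiset.singleton_le.2 (by simp))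
  -- Exactly `A.card` pairs contain `z`, counting `{z, z}`. So the pairs avoiding `z`, each
  -- multiplied by `z`, together with the cube of `z` meet the bound.
  refine ⟨insert {z, z, z} ((cliques c (A.erase z) 2).image (Multiset.cons z)), ?_, ?_, ?_⟩
  · refine Finset.insert_subset ((triple_mem_cliques hc).2 ?_) ?_
    · exact ⟨hz, ⟨hz, hz, hzc z⟩, hzc z, hzc z⟩
    · intro M hM
      obtain ⟨N, hN, rfl⟩ := Finset.mem_image.1 hM
      exact (cons_mem_cliques hc).2
        ⟨hz, cliques_mono (Finset.erase_subset _ _) (fun _ _ _ _ h => h) _ hN, fun u _ => hzc u⟩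
  · have h1 := Finset.card_insert_le {z, z, z}
      ((cliques c (A.erase z) 2).image (Multiset.cons z))
    have h2 : ((cliques c (A.erase z) 2).image (Multiset.cons z)).card ≤ _ := Finset.card_image_le
    simp only [Nat.reduceAdd] at hcard
    omega
  · intro P hP
    obtain ⟨u, v, rfl⟩ := Multiset.card_eq_two.1 (mem_cliques.1 hP).1
    obtain ⟨hu, hv, huv⟩ := (pair_mem_cliques hc).1 hP
    by_cases huz : u = z
    · subst huz
      exact hzu v hv
    by_cases hvz : v = z
    · subst hvz
      rw [Multiset.pair_comm u v]
      exact hzu u hu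
    exact ⟨_, Finset.mem_insert_of_mem (hmem u v hu hv huz hvz huv), Multiset.le_cons_self _ _⟩

/-- A cover of the pairs when all of them contain `z`. -/
theorem exists_cover_of_star {c : V → V → Prop} (hc : ∀ u v, c u v → c v u) {Y : Finset V} {z : V}
    (hzc : ∀ u, c z u) (hY : Y.Nonempty) (h : ∀ u ∈ Y, ∀ v ∈ Y, ¬ c u v) :
    ∃ C ⊆ cliques c (insert z Y) 3, C.card ≤ Y.card ∧
      ∀ P ∈ cliques c (insert z Y) 2, ∃ Q ∈ C, P ≤ Q := by
  have hzu : ∀ u ∈ insert z Y, ∃ Q ∈ Y.image fun y => ({z, z, y} : Multiset V), {z, u} ≤ Q := by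
    intro u hu
    rcases Finset.mem_insert.1 hu with rfl | hu
    · obtain ⟨y, hy⟩ := hY
      exact ⟨_, Finset.mem_image_of_mem _ hy,
        (Multiset.cons_le_cons_iff u).2 (Multiset.singleton_le.2 (by simp))⟩
    · exact ⟨_, Finset.mem_image_of_mem _ hu, Multiset.le_cons_self _ _⟩
  refine ⟨Y.image fun y => {z, z, y}, ?_, Finset.card_image_le, ?_⟩
  · intro M hM
    obtain ⟨y, hy, rfl⟩ := Finset.mem_image.1 hM
    rw [triple_mem_cliques hc]
    simp [hy, hzc]
  · intro P hP
    obtain ⟨u, v, rfl⟩ := Multiset.card_eq_two.1 (mem_cliques.1 hP).1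
    obtain ⟨hu, hv, huv⟩ := (pair_mem_cliques hc).1 hP
    rcases Finset.mem_insert.1 hu with rfl | hu'
    · exact hzu v hv
    rcases Finset.mem_insert.1 hv with rfl | hv'
    · rw [Multiset.pair_comm u]
      exact hzu u hu
    exact (h u hu' v hv' huv).elim

end Cover

/-! ### Transversals, the match with the h-vector, and extremal configurations -/

namespace FaceComplex

variable {V : Type*} [DecidableEq V] {Δ : FaceComplex V} [Fintype V]

/-- A face extends to a transversal of the parallel classes. -/
theorem exists_transversal {B : Finset V} (hB : B ∈ Δ) :
    ∃ R ⊆ Δ.nonloops, B ⊆ R ∧ (∀ u ∈ R, ∀ v ∈ R, u ≠ v → Δ.Npar u v) ∧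
      ∀ x ∈ Δ.nonloops, ∃ r ∈ R, ¬ Δ.Npar x r := by
  obtain ⟨R, hBR, hR⟩ := (Set.toFinite {R : Finset V | R ⊆ Δ.nonloops ∧
    ∀ u ∈ R, ∀ v ∈ R, u ≠ v → Δ.Npar u v}).exists_le_maximal (a := B)
    ⟨subset_nonloops hB, fun u hu v hv => npar_of_mem hB hu hv⟩
  refine ⟨R, hR.prop.1, hBR, hR.prop.2, fun x hx => ?_⟩
  by_contra! hall
  refine npar_irrefl (hall x (hR.le_of_ge (y := insert x R) ⟨Finset.insert_subset hx hR.prop.1, ?_⟩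
    (Finset.subset_insert x R) (Finset.mem_insert_self x R)))
  intro u hu v hv huv
  rcases Finset.mem_insert.1 hu with rfl | hu'
  · exact hall v ((Finset.mem_insert.1 hv).resolve_left huv.symm)
  · rcases Finset.mem_insert.1 hv with rfl | hv'
    · exact (hall u hu').symm
    · exact hR.prop.2 u hu' v hv' huv

namespace IsMatroidComplex

/-- The numbers of cliques on the variables attached to a transversal `R = Z ∪ B` of the
parallel classes, where `B` is a basis. -/
theorem clique_counts (hΔ : Δ.IsMatroidComplex) {B R : Finset V} (hB3 : B.card = 3) (hBR : B ⊆ R)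
    (hRE : R ⊆ Δ.nonloops) (hR : ∀ u ∈ R, ∀ v ∈ R, u ≠ v → Δ.Npar u v)
    (hRt : ∀ x ∈ Δ.nonloops, ∃ r ∈ R, ¬ Δ.Npar x r) :
    let A := R \ B ∪ Δ.nonloops \ R
    let c := withFree Δ.Npar (R \ B)
    (A.card : ℤ) = Δ.nonloops.card - 3 ∧
    ((cliques c A 2).card : ℤ) = Δ.faceCount 2 - 2 * Δ.nonloops.card + 3 ∧
    ((cliques c A 3).card : ℤ) =
      (cliques Δ.Npar Δ.nonloops 3).card - Δ.faceCount 2 + Δ.nonloops.card - 1 := by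
  intro A c
  have hd : Disjoint R (Δ.nonloops \ R) := Finset.disjoint_sdiff
  have hZd : Disjoint (R \ B) (Δ.nonloops \ R) :=
    Finset.disjoint_of_subset_left Finset.sdiff_subset hd
  have hrep : ∀ x, ∃ r, x ∈ Δ.nonloops → r ∈ R ∧ ¬ Δ.Npar x r := fun x => by
    by_cases hx : x ∈ Δ.nonloops
    · obtain ⟨r, hr⟩ := hRt x hx
      exact ⟨r, fun _ => hr⟩
    · exact ⟨x, fun h => (hx h).elim⟩
  choose ρ hρ using hrep
  have hρ1 : ∀ b ∈ Δ.nonloops \ R, ρ b ∈ R ∧ ∀ u ∈ R, Δ.Npar b u ↔ u ≠ ρ b := by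
    intro b hb
    have hbE := (Finset.mem_sdiff.1 hb).1
    refine ⟨(hρ b hbE).1, fun u hu => ⟨?_, fun h => ?_⟩⟩
    · rintro h rfl
      exact (hρ b hbE).2 h
    · exact (hΔ.npar_or_npar (mem_nonloops.1 hbE) (hR u hu _ (hρ b hbE).1 h)).resolve_right
        (hρ b hbE).2
  have hρ2 : ∀ b ∈ Δ.nonloops \ R, ∀ b' ∈ Δ.nonloops \ R, Δ.Npar b b' → ρ b ≠ ρ b' := by
    intro b hb b' hb' h heq
    have h1 := hρ b (Finset.mem_sdiff.1 hb).1
    have h2 := hρ b' (Finset.mem_sdiff.1 hb').1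
    rcases hΔ.npar_or_npar (mem_nonloops.1 (hRE h1.1)) h with h' | h'
    · exact h1.2 h'.symm
    · exact h2.2 (heq ▸ h'.symm)
  have e1 := cliques_transversal_two Δ.npar_comm (fun _ => npar_irrefl) hR hd ρ hρ1
  have e2 := cliques_transversal_three Δ.npar_comm (fun _ => npar_irrefl) hR hd ρ hρ1 hρ2
  have e3 := cliques_withFree_two Δ.npar_comm (fun _ => npar_irrefl) hZd
  have e4 := cliques_withFree_three Δ.npar_comm (fun _ => npar_irrefl) hZd
  rw [Finset.union_sdiff_of_subset hRE] at e1 e2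
  have e5 := Finset.card_sdiff_add_card_eq_card hBR
  have e6 := Finset.card_sdiff_add_card_eq_card hRE
  rw [← faceCount_two] at e1
  have e7 : A.card = (R \ B).card + (Δ.nonloops \ R).card := Finset.card_union_of_disjoint hZd
  rw [hB3] at e5
  zify at e3 e4 e5 e6 e7
  rw [← e5] at e1 e2 e6
  rw [← e6, e7]
  -- After substituting |R| = |R \ B| + 3, the cliques inside `Δ.nonloops \ R` cancel and only
  -- polynomial identities remain.
  refine ⟨by ring, ?_, ?_⟩
  · rw [← mul_right_inj' (two_ne_zero (α := ℤ))]
    linear_combination e3 - e1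
  · rw [← mul_right_inj' (show (6 : ℤ) ≠ 0 by norm_num)]
    linear_combination e4 - e2 + 3 * e1

/-- Deleting the coloop `x` matches bases with edges avoiding `x`, and `x` forms an edge with every
other non-loop. In terms of the h-vector this is h₃ = 0. -/
theorem faceCount_three_of_coloop (hΔ : Δ.IsMatroidComplex) (hr : Δ.rank = 3) {x : V}
    (hx : ∀ B ∈ Δ, B.card = 3 → x ∈ B) (h0 : (∅ : Finset V) ∈ Δ) :
    Δ.faceCount 3 + Δ.nonloops.card = Δ.faceCount 2 + 1 := by
  classical
  have hext : ∀ F ∈ Δ, ∃ G ∈ Δ, F ⊆ G ∧ G.card = 3 ∧ x ∈ G := by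
    intro F hF
    obtain ⟨G, hG, hFG, hc⟩ := hΔ.exists_basis hF
    rw [hr] at hc
    exact ⟨G, hG, hFG, hc, hx G hG hc⟩
  obtain ⟨G₀, hG₀, -, -, hxG₀⟩ := hext ∅ h0
  have hxE : x ∈ Δ.nonloops := subset_nonloops hG₀ hxG₀
  have hnp : (Δ.nonloops.erase x).filter (Δ.Npar x) = Δ.nonloops.erase x :=
    Finset.filter_true_of_mem fun y hy => by
      rw [Finset.mem_erase] at hy
      obtain ⟨G, hG, hyG, -, hxG⟩ := hext {y} (mem_nonloops.1 hy.2)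
      exact npar_of_mem hG hxG (hyG (by simp)) hy.1.symm
  have e1 := cliques_card_insert_of_irrefl Δ.npar_comm (fun _ => npar_irrefl)
    (Finset.notMem_erase x Δ.nonloops) 1
  rw [Finset.insert_erase hxE, hnp, cliques_card_one, Finset.card_erase_of_mem hxE, ← faceCount_two,
    ← card_filter_faces_two] at e1
  have e2 : Δ.faceCount 3 =
      (Δ.faces.filter fun F => F.card = 2 ∧ F ⊆ Δ.nonloops.erase x).card := by
    rw [faceCount]
    refine Finset.card_bij' (fun F _ => F.erase x) (fun F _ => insert x F) ?_ ?_ ?_ ?_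
    · intro F hF
      simp only [Finset.mem_filter, mem_faces] at hF ⊢
      refine ⟨mem_of_subset hF.1 (Finset.erase_subset _ _), ?_,
        Finset.erase_subset_erase _ (subset_nonloops hF.1)⟩
      rw [Finset.card_erase_of_mem (hx F hF.1 hF.2), hF.2]
    · intro F hF
      simp only [Finset.mem_filter, mem_faces] at hF ⊢
      have hxF : x ∉ F := fun h => Finset.notMem_erase x _ (hF.2.2 h)
      obtain ⟨G, hG, hFG, hc, hxG⟩ := hext F hF.1
      refine ⟨mem_of_subset hG (Finset.insert_subset hxG hFG), ?_⟩
      rw [Finset.card_insert_of_notMem hxF, hF.2.1]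
    · intro F hF
      simp only [Finset.mem_filter, mem_faces] at hF
      exact Finset.insert_erase (hx F hF.1 hF.2)
    · intro F hF
      simp only [Finset.mem_filter] at hF
      exact Finset.erase_insert fun h => Finset.notMem_erase x _ (hF.2.2 h)
  have : 0 < Δ.nonloops.card := Finset.card_pos.2 ⟨x, hxE⟩
  omega

/-- With a single non-trivial parallel class `P` and three other elements, none of which is a
coloop, any two of these form a basis with any element of `P`. -/
theorem three_mul_card_le (hΔ : Δ.IsMatroidComplex) {P T : Finset V} (hE : P ∪ T = Δ.nonloops)
    (hd : Disjoint P T) (hT : T.card = 3) (hP : ∀ u ∈ P, ∀ v ∈ P, ¬ Δ.Npar u v)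
    (hco : ∀ x, ∃ B ∈ Δ, B.card = 3 ∧ x ∉ B) : 3 * P.card ≤ Δ.faceCount 3 := by
  have hPT : ∀ e ∈ P, e ∉ T := fun _ => (Finset.disjoint_left.1 hd ·)
  have hface : ∀ x ∈ T, ∀ e ∈ P, insert e (T.erase x) ∈ Δ := by
    intro x hx e he
    obtain ⟨B, hB, hB3, hxB⟩ := hco x
    have h1 : (B ∩ P).card ≤ 1 := Finset.card_le_one.2 fun u hu v hv => by
      rw [Finset.mem_inter] at hu hv
      by_contra huv
      exact hP u hu.2 v hv.2 (npar_of_mem hB hu.1 hv.1 huv)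
    have hsub : B \ P ⊆ T.erase x := fun u hu => by
      rw [Finset.mem_sdiff] at hu
      have := subset_nonloops hB hu.1
      rw [← hE, Finset.mem_union] at this
      exact Finset.mem_erase.2 ⟨fun h => hxB (h ▸ hu.1), this.resolve_left hu.2⟩
    have hTx : (T.erase x).card = 2 := by rw [Finset.card_erase_of_mem hx, hT]
    have h2 := Finset.card_le_card hsub
    have h3 := Finset.card_inter_add_card_sdiff B P
    -- A basis avoiding `x` has at most one element in `P`, so it uses both other elements of `T`;
    -- its element of `P` can then be exchanged for any parallel one.
    have heq : B \ P = T.erase x := Finset.eq_of_subset_of_card_le hsub (by omega)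
    obtain ⟨f, hf⟩ : (B ∩ P).Nonempty := Finset.card_pos.1 (by omega)
    rw [Finset.mem_inter] at hf
    have h4 := hΔ.insert_erase_mem hB hf.1 (mem_nonloops.1
      (hE ▸ Finset.mem_union_left _ he)) (hP f hf.2 e he)
    refine mem_of_subset h4 (Finset.insert_subset_insert e fun u hu => ?_)
    rw [← heq, Finset.mem_sdiff] at hu
    exact Finset.mem_erase.2 ⟨fun h => hu.2 (h ▸ hf.2), hu.1⟩
  rw [← hT, ← Finset.card_product, faceCount]
  refine Finset.card_le_card_of_injOn (fun p => insert p.2 (T.erase p.1)) ?_ ?_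
  · rintro ⟨x, e⟩ hp
    rw [Finset.mem_coe, Finset.mem_product] at hp
    rw [Finset.mem_coe, Finset.mem_filter, mem_faces]
    refine ⟨hface x hp.1 e hp.2, ?_⟩
    rw [Finset.card_insert_of_notMem fun h => hPT e hp.2 (Finset.mem_of_mem_erase h),
      Finset.card_erase_of_mem hp.1, hT]
  · rintro ⟨x, e⟩ hp ⟨y, f⟩ hq heq
    rw [Finset.mem_coe, Finset.mem_product] at hp hq
    simp only at heq hp hq
    have hef : e = f := by
      have : e ∈ insert f (T.erase y) := heq ▸ Finset.mem_insert_self _ _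
      exact (Finset.mem_insert.1 this).resolve_right
        fun h => hPT e hp.2 (Finset.mem_of_mem_erase h)
    have hxy : x = y := by
      by_contra hxy
      have : x ∈ insert e (T.erase x) := by
        rw [heq]
        exact Finset.mem_insert_of_mem (Finset.mem_erase.2 ⟨hxy, hp.1⟩)
      rcases Finset.mem_insert.1 this with rfl | h
      · exact hPT _ hp.2 hp.1
      · exact Finset.notMem_erase _ _ h
    rw [hxy, hef]

/-- If there are only three parallel classes, then all transversals are bases. -/
theorem card_cliques_le_faceCount_three (hΔ : Δ.IsMatroidComplex) {B : Finset V} (hB : B ∈ Δ)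
    (hB3 : B.card = 3) (hBt : ∀ x ∈ Δ.nonloops, ∃ r ∈ B, ¬ Δ.Npar x r) :
    (cliques Δ.Npar Δ.nonloops 3).card ≤ Δ.faceCount 3 := by
  rw [faceCount_eq]
  refine card_cliques_le _ _ fun F hF => ?_
  obtain ⟨x, y, z, hxy, hxz, hyz, rfl⟩ := Finset.card_eq_three.1 (mem_cliques.1 hF).1
  have hFv : ({x, y, z} : Finset V).val = {x, y, z} := by
    simp [Finset.insert_val, hxy, hxz, hyz]
  rw [hFv, triple_mem_cliques Δ.npar_comm] at hF
  obtain ⟨hx, ⟨hy, hz, nyz⟩, nxy, nxz⟩ := hF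
  have hrep : ∀ u, ∃ r, u ∈ Δ.nonloops → r ∈ B ∧ ¬ Δ.Npar u r := fun u => by
    by_cases hu : u ∈ Δ.nonloops
    · obtain ⟨r, hr⟩ := hBt u hu
      exact ⟨r, fun _ => hr⟩
    · exact ⟨u, fun h => (hu h).elim⟩
  choose ρ hρ using hrep
  have hne : ∀ u v, u ∈ Δ.nonloops → v ∈ Δ.nonloops → Δ.Npar u v → ρ u ≠ ρ v := by
    intro u v hu hv huv heq
    rcases hΔ.npar_or_npar (mem_nonloops.1 (subset_nonloops hB (hρ u hu).1)) huv with h | h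
    · exact (hρ u hu).2 h.symm
    · exact (hρ v hv).2 (heq ▸ h.symm)
  have himg : ({ρ x, ρ y, ρ z} : Finset V) = B := by
    refine Finset.eq_of_subset_of_card_le ?_ ?_
    · intro u
      simp only [Finset.mem_insert, Finset.mem_singleton]
      rintro (rfl | rfl | rfl)
      exacts [(hρ x hx).1, (hρ y hy).1, (hρ z hz).1]
    · rw [hB3, Finset.card_eq_three.2 ⟨ρ x, ρ y, ρ z, hne x y hx hy nxy, hne x z hx hz nxz,
        hne y z hy hz nyz, rfl⟩]
  -- Otherwise `x`, `y`, `z` lie on one line. A line is closed under parallelism, so their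
  -- representatives, which make up `B`, would lie on it too.
  by_contra hn
  have hzl : z ∈ Δ.line x y := mem_line.2 ⟨hz, fun h => hn (by
    have : ({x, y, z} : Finset V) = {z, x, y} := by
      rw [Finset.insert_comm z x, Finset.pair_comm z y]
    rw [this]
    exact h.2.2)⟩
  have hmem : ∀ u ∈ Δ.line x y, ρ u ∈ Δ.line x y := fun u hu => by
    by_contra h
    have huE := line_subset _ _ hu
    exact (hρ u huE).2
      (hΔ.npar_of_notMem_line nxy hu (subset_nonloops hB (hρ u huE).1) h).symm
  have := hΔ.card_le_two_of_subset_line nxy hB (by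
    rw [← himg]
    intro u
    simp only [Finset.mem_insert, Finset.mem_singleton]
    rintro (rfl | rfl | rfl)
    exacts [hmem x (left_mem_line nxy), hmem y (right_mem_line nxy), hmem z hzl])
  omega

end IsMatroidComplex

end FaceComplex

/-! ### Covers with at most h₃ triples -/

namespace FaceComplex

variable {V : Type*} [DecidableEq V] {Δ : FaceComplex V} [Fintype V]

/-- If there are three parallel classes, every pair is contained in a triple. -/
theorem IsMatroidComplex.exists_triple_of_pair (hΔ : Δ.IsMatroidComplex) {A : Finset V}
    (hA : A ⊆ Δ.nonloops) (hne : (cliques Δ.Npar A 3).Nonempty) :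
    ∀ P ∈ cliques Δ.Npar A 2, ∃ Q ∈ cliques Δ.Npar A 3, P ≤ Q := by
  intro P hP
  obtain ⟨M, hM⟩ := hne
  obtain ⟨x, y, z, rfl⟩ := Multiset.card_eq_three.1 (mem_cliques.1 hM).1
  obtain ⟨a, b, rfl⟩ := Multiset.card_eq_two.1 (mem_cliques.1 hP).1
  rw [triple_mem_cliques Δ.npar_comm] at hM
  obtain ⟨hx, ⟨hy, hz, hyz⟩, hxy, hxz⟩ := hM
  have hab := (pair_mem_cliques Δ.npar_comm).1 hP
  have key : ∀ w ∈ A, Δ.Npar a w → Δ.Npar b w → ∃ Q ∈ cliques Δ.Npar A 3, {a, b} ≤ Q := by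
    intro w hw h1 h2
    refine ⟨w ::ₘ {a, b}, (cons_mem_cliques Δ.npar_comm).2 ⟨hw, hP, ?_⟩, Multiset.le_cons_self _ _⟩
    simp [h1.symm, h2.symm]
  -- Each element is parallel to at most one of `x`, `y`, `z`, so `a` and `b` have a common
  -- non-parallel element among the three.
  have two : ∀ e ∈ A, (Δ.Npar e x ∧ Δ.Npar e y) ∨ (Δ.Npar e x ∧ Δ.Npar e z) ∨
      (Δ.Npar e y ∧ Δ.Npar e z) := fun e he => by
    have he := mem_nonloops.1 (hA he)
    have h1 := hΔ.npar_or_npar he hxy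
    have h2 := hΔ.npar_or_npar he hxz
    have h3 := hΔ.npar_or_npar he hyz
    tauto
  rcases two a hab.1 with ⟨h1, h2⟩ | ⟨h1, h2⟩ | ⟨h1, h2⟩ <;>
    rcases two b hab.2.1 with ⟨h3, h4⟩ | ⟨h3, h4⟩ | ⟨h3, h4⟩ <;>
    first
      | exact key x hx ‹_› ‹_›
      | exact key y hy ‹_› ‹_›
      | exact key z hz ‹_› ‹_›

/-- A cover of the pairs by at most `h₃` triples for a matroid complex without coloops. -/
theorem IsMatroidComplex.exists_small_cover (hΔ : Δ.IsMatroidComplex)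
    (hco : ∀ x, ∃ B ∈ Δ, B.card = 3 ∧ x ∉ B) {B R : Finset V} (hB : B ∈ Δ) (hB3 : B.card = 3)
    (hBR : B ⊆ R) (hRE : R ⊆ Δ.nonloops) (hR : ∀ u ∈ R, ∀ v ∈ R, u ≠ v → Δ.Npar u v)
    (hRt : ∀ x ∈ Δ.nonloops, ∃ r ∈ R, ¬ Δ.Npar x r) {z : V} (hz : z ∈ R \ B) :
    let A := R \ B ∪ Δ.nonloops \ R
    let c := withFree Δ.Npar (R \ B)
    ∃ C ⊆ cliques c A 3, (C.card : ℤ) ≤ Δ.faceCount 3 - Δ.faceCount 2 + Δ.nonloops.card - 1 ∧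
      ∀ P ∈ cliques c A 2, ∃ Q ∈ C, P ≤ Q := by
  intro A c
  obtain ⟨e1, e2, -⟩ := hΔ.clique_counts hB3 hBR hRE hR hRt
  have hc : ∀ u v, c u v → c v u := withFree_symm Δ.npar_comm _
  have hzc : ∀ u, c z u := fun u => Or.inl hz
  have hzA : z ∈ A := Finset.mem_union_left _ hz
  by_cases h : ∀ v ∈ A.erase z, ∃ w ∈ A.erase z, c v w
  · obtain ⟨C, hC, hCc, hcov⟩ := exists_cover hc hzA hzc h
    refine ⟨C, hC, ?_, hcov⟩
    have hpair : ∃ a b, Δ.Npar a b := by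
      obtain ⟨x, y, w, hxy, -, -, rfl⟩ := Finset.card_eq_three.1 hB3
      exact ⟨x, y, npar_of_mem hB (by simp) (by simp) hxy⟩
    have := hΔ.two_mul_faceCount_two_le hco hpair
    zify at hCc this
    change (A.card : ℤ) = _ at e1
    change ((cliques c A 2).card : ℤ) = _ at e2
    linarith
  -- A variable `v` compatible only with `z` forces `R \ B = {z}` and puts all of `Δ.nonloops \ R`
  -- in the class of `v`: one class `P` and three further elements.
  · push Not at h
    obtain ⟨v, hv, hvw⟩ := h
    obtain ⟨hvz, hvA⟩ := Finset.mem_erase.1 hv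
    have hvZ : v ∉ R \ B := fun h => hvw v hv (Or.inl h)
    have hvY : v ∈ Δ.nonloops \ R := (Finset.mem_union.1 hvA).resolve_left hvZ
    have hZ : R \ B = {z} := by
      refine Finset.eq_singleton_iff_unique_mem.2 ⟨hz, fun u hu => ?_⟩
      by_contra huz
      exact hvw u (Finset.mem_erase.2 ⟨huz, Finset.mem_union_left _ hu⟩) (Or.inr (Or.inl hu))
    have hYz : ∀ y ∈ Δ.nonloops \ R, y ≠ z := by
      rintro y hy rfl
      exact (Finset.mem_sdiff.1 hy).2 (Finset.mem_sdiff.1 hz).1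
    have hvy : ∀ y ∈ Δ.nonloops \ R, ¬ Δ.Npar v y := fun y hy h =>
      hvw y (Finset.mem_erase.2 ⟨hYz y hy, Finset.mem_union_right _ hy⟩) (Or.inr (Or.inr h))
    have hvE := (Finset.mem_sdiff.1 hvY).1
    obtain ⟨r, hr, hvr⟩ := hRt v hvE
    have hvP : ∀ y ∈ insert r (Δ.nonloops \ R), ¬ Δ.Npar v y := fun y hy => by
      rcases Finset.mem_insert.1 hy with rfl | hy
      · exact hvr
      · exact hvy y hy
    have hPP : ∀ u ∈ insert r (Δ.nonloops \ R), ∀ w ∈ insert r (Δ.nonloops \ R),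
        ¬ Δ.Npar u w := fun u hu w hw h =>
      (hΔ.npar_or_npar (mem_nonloops.1 hvE) h).elim (hvP u hu) (hvP w hw)
    have hR4 : R.card = 4 := by
      have := Finset.card_sdiff_add_card_eq_card hBR
      rw [hZ, hB3, Finset.card_singleton] at this
      omega
    have hrY : r ∉ Δ.nonloops \ R := fun h => (Finset.mem_sdiff.1 h).2 hr
    have hd : Disjoint (insert r (Δ.nonloops \ R)) (R.erase r) := by
      rw [Finset.disjoint_insert_left]
      exact ⟨Finset.notMem_erase r R, Finset.disjoint_of_subset_right (Finset.erase_subset r R)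
        Finset.sdiff_disjoint⟩
    have hun : insert r (Δ.nonloops \ R) ∪ R.erase r = Δ.nonloops := by
      rw [Finset.insert_union, ← Finset.union_insert, Finset.insert_erase hr,
        Finset.sdiff_union_of_subset hRE]
    have h3 := hΔ.three_mul_card_le hun hd (by rw [Finset.card_erase_of_mem hr, hR4]) hPP hco
    rw [Finset.card_insert_of_notMem hrY] at h3
    have hA : A = insert z (Δ.nonloops \ R) := by
      simp only [A]
      rw [hZ]
      rfl
    have hstar : ∀ u ∈ Δ.nonloops \ R, ∀ w ∈ Δ.nonloops \ R, ¬ c u w := by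
      intro u hu w hw h
      simp only [c, withFree, hZ, Finset.mem_singleton, hYz u hu, hYz w hw, false_or] at h
      exact hPP u (Finset.mem_insert_of_mem hu) w (Finset.mem_insert_of_mem hw) h
    obtain ⟨C, hC, hCc, hcov⟩ := exists_cover_of_star hc hzc ⟨v, hvY⟩ hstar
    rw [← hA] at hC hcov
    refine ⟨C, hC, ?_, hcov⟩
    have e5 : A.card = (Δ.nonloops \ R).card + 1 := by
      rw [hA, Finset.card_insert_of_notMem fun h => hYz z h rfl]
    have e6 : (cliques c A 2).card = A.card := by
      have hYc : (cliques c (Δ.nonloops \ R) 2).card = 0 := by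
        rw [Finset.card_eq_zero, Finset.eq_empty_iff_forall_notMem]
        intro M hM
        obtain ⟨u, w, rfl⟩ := Multiset.card_eq_two.1 (mem_cliques.1 hM).1
        obtain ⟨hu, hw, h⟩ := (pair_mem_cliques hc).1 hM
        exact hstar u hu w hw h
      have := cliques_card_insert hc (A := Δ.nonloops \ R) (N := A) (a := z)
        (fun h => hYz z h rfl) (fun u => by rw [hA]; exact ⟨fun h => ⟨h, hzc u⟩, fun h => h.1⟩) 1
      rw [← hA, cliques_card_one] at this
      simp only [Nat.reduceAdd] at this
      omega
    change (A.card : ℤ) = _ at e1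
    change ((cliques c A 2).card : ℤ) = _ at e2
    -- With y = |`Δ.nonloops \ R`|: n = y + 4, f₁ = 3y + 6 and f₂ ≥ 3(y + 1), whence h₃ ≥ y.
    omega

end FaceComplex

/-! ### Assembly of the cases -/

theorem mainTheorem1 {V : Type*} [Fintype V] (Δ : FaceComplex V)
    (hΔ : Δ.IsMatroidComplex) (hrank : Δ.rank = 3) :
    IsPureOSequence Δ.hVector := by
  classical
  obtain ⟨h0, h1, h2, h3, h4⟩ := FaceComplex.hVector_of_rank_three hrank
  obtain ⟨F, hF⟩ : ∃ F, F ∈ Δ := by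
    by_contra! h
    have : Δ.faces = ∅ := Finset.eq_empty_iff_forall_notMem.2 fun F hF =>
      h F (FaceComplex.mem_faces.1 hF)
    rw [FaceComplex.rank, this] at hrank
    simp at hrank
  have hempty : (∅ : Finset V) ∈ Δ := FaceComplex.mem_of_subset hF (Finset.empty_subset F)
  obtain ⟨B, hB, hB3⟩ := FaceComplex.exists_card_eq_rank hF
  rw [hrank] at hB3
  obtain ⟨R, hRE, hBR, hR, hRt⟩ := FaceComplex.exists_transversal hB
  obtain ⟨e1, e2, e3⟩ := hΔ.clique_counts hB3 hBR hRE hR hRt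
  have hc := withFree_symm Δ.npar_comm (R \ B)
  have hle : Δ.faceCount 3 ≤ _ := FaceComplex.faceCount_le 3
  rcases Finset.eq_empty_or_nonempty (R \ B) with hZ | ⟨z, hz⟩
  · have hRB : R = B := (Finset.sdiff_eq_empty_iff_subset.1 hZ).antisymm hBR
    have hw : withFree Δ.Npar ∅ = Δ.Npar := by
      ext u v
      simp [withFree]
    rw [hZ, Finset.empty_union] at e1 e2 e3
    rw [hw] at e2 e3
    have hge := hΔ.card_cliques_le_faceCount_three hB hB3 (hRB ▸ hRt)
    refine isPureOSequence_of_cliques Δ.Npar (Δ.nonloops \ R) _ _ subset_rfl ?_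
      (hΔ.exists_triple_of_pair Finset.sdiff_subset) h0 (h1.trans e1.symm) (h2.trans e2.symm)
      ?_ h4
    · rintro ⟨M, hM⟩ a ha
      obtain ⟨u, v, rfl⟩ := Multiset.card_eq_two.1 (mem_cliques.1 hM).1
      obtain ⟨hu, hv, huv⟩ := (pair_mem_cliques Δ.npar_comm).1 hM
      rcases hΔ.npar_or_npar (FaceComplex.mem_nonloops.1 (Finset.mem_sdiff.1 ha).1) huv with h | h
      · exact ⟨{a, u}, (pair_mem_cliques Δ.npar_comm).2 ⟨ha, hu, h⟩, by simp⟩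
      · exact ⟨{a, v}, (pair_mem_cliques Δ.npar_comm).2 ⟨ha, hv, h⟩, by simp⟩
    · rw [h3, e3, le_antisymm hle hge]
  · have hpair : ∀ a ∈ R \ B ∪ Δ.nonloops \ R,
        ∃ P ∈ cliques (withFree Δ.Npar (R \ B)) (R \ B ∪ Δ.nonloops \ R) 2, a ∈ P := fun a ha =>
      ⟨{a, z}, (pair_mem_cliques hc).2 ⟨ha, Finset.mem_union_left _ hz, Or.inr (Or.inl hz)⟩,
        by simp⟩
    by_cases hco : ∀ x, ∃ B ∈ Δ, B.card = 3 ∧ x ∉ B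
    · obtain ⟨C, hC, hCc, hcov⟩ := hΔ.exists_small_cover hco hB hB3 hBR hRE hR hRt hz
      obtain ⟨n, hn⟩ : ∃ n : ℕ, Δ.hVector 3 = n :=
        Int.eq_ofNat_of_zero_le (by rw [h3]; exact (Nat.cast_nonneg _).trans hCc)
      -- There is room for `S`: h₃ is at least the size of the cover, and at most the number of all
      -- 3-cliques since bases are triples of pairwise non-parallel elements.
      obtain ⟨S, hCS, hS, hSn⟩ := Finset.exists_subsuperset_card_eq hC (n := n)
        (by omega) (by omega)
      refine isPureOSequence_of_cliques _ _ S _ hS (fun _ => hpair) ?_ h0 (h1.trans e1.symm)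
        (h2.trans e2.symm) (by rw [hn, hSn]) h4
      intro _ P hP
      obtain ⟨Q, hQ, hPQ⟩ := hcov P hP
      exact ⟨Q, hCS hQ, hPQ⟩
    · push Not at hco
      obtain ⟨x, hx⟩ := hco
      have := hΔ.faceCount_three_of_coloop hrank hx hempty
      refine isPureOSequence_of_cliques _ _ ∅ _ (Finset.empty_subset _) (fun _ => hpair) ?_ h0
        (h1.trans e1.symm) (h2.trans e2.symm) ?_ h4
      · intro h
        simp at h
      · rw [h3, Finset.card_empty]
        omega
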